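/- All graphs are finite and simple. For a graph $H$ and an integer $k\ge 0$, let $m(H,k)$ denote the number of vertices of degree $k$ in $H$. A spanning subgraph of $G$ is a graph with the same vertex set as $G$ whose edges are edges of $G$; a graph is cubic if every vertex has degree $3$; $3K_4$ is the disjoint union of three copies of $K_4$. Let $G$ be a cubic graph on $n$ vertices. (a) If $G$ is not isomorphic to $K_4$, $3K_4$ or $K_{3,3}$, then $G$ has a spanning subgraph $H$ such that $$\left| m(H,k)-\frac n4\right| \le \frac12\qquad\text{for every } k\in\{0,1,2,3\}.$$ (b) If $G$ is isomorphic to $K_4$, $3K_4$ or $K_{3,3}$, then $G$ has no spanning subgraph as in (a), but it has a spanning subgraph $H$ such that $$\max_{0\le k\le 3}\left| m(H,k)-\frac n4\right| \le \frac32 .$$ (c) Consequently, the Alon--Wei conjecture holds for cubic graphs: every cubic graph $G$ on $n$ vertices has a spanning subgraph $H$ such that $\left| m(H,k)-\frac n4\right| \le 2$ for every $k\in\{0,1,2,3\}$. -/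

import Mathlib

open Classical in
/-- `m(H, k)`: the number of vertices of degree `k` in the finite graph `H`. -/
noncomputable def degreeCount {V : Type*} [Fintype V] (H : SimpleGraph V) (k : ℕ) : ℕ :=
  (Finset.univ.filter fun v : V => H.degree v = k).card

/-- `G` has a spanning subgraph `H` (same vertex set, a subset of the edges) in which, for each
`k = 0, 1, 2, 3`, the number of vertices of degree `k` differs from `n / 4` by at most `c`. -/
def HasDegreeBalancedSubgraph {V : Type*} [Fintype V] (G : SimpleGraph V) (c : ℝ) : Prop :=
  ∃ H : SimpleGraph V, H ≤ G ∧
    ∀ k : ℕ, k ≤ 3 → |(degreeCount H k : ℝ) - (Fintype.card V : ℝ) / 4| ≤ c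

/-- `G` is isomorphic to `K₄`, to `3K₄` (three disjoint copies of `K₄`) or to `K₃,₃`. -/
def IsExceptionalCubic {V : Type*} (G : SimpleGraph V) : Prop :=
  Nonempty (G ≃g SimpleGraph.completeGraph (Fin 4)) ∨
  Nonempty (G ≃g SimpleGraph.sum (SimpleGraph.sum (SimpleGraph.completeGraph (Fin 4))
    (SimpleGraph.completeGraph (Fin 4))) (SimpleGraph.completeGraph (Fin 4))) ∨
  Nonempty (G ≃g completeBipartiteGraph (Fin 3) (Fin 3))

/-! Record a spanning subgraph by its vector of numbers of vertices of degrees 0, 1, 2, 3.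
Complementation inside the cubic graph `G` reverses the vector, and deleting or adding an edge
changes it by an amount that depends only on the two end degrees. The target vectors are (q,q,q,q)
and, up to reversal, (q+1,q,q+1,q).

Connected case, 2q+2p vertices with q ≥ 2 and p = q or q+1: among the subgraphs with at most q, p, q
vertices of degrees 0, 1, 2, take one with fewest edges (`exists_extremal`). If at most p vertices
have degree 3, the total forces (q,p,q,p). Otherwise every local change that respects the bounds and
loses edges is impossible; with parity and double counting, only (q,p-1,q,p+1) and (q-1,p,q-1,p+2)
survive (`Extremal.cases_of_lt`). In the second, an edge joining two leaves can be slid along `G`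
until it reaches a vertex of degree 3, which is absurd (`Extremal.not_pred_pred`). The first falls
to exchanges of a few edges; for p = q+1 these may instead reach the reversed target. Order 4 gives
only K₄; order 6 gives K₃,₃ or a graph with a triangle, which is balanced by hand.

Gluing: vectors of disjoint closed sets add. A balanced component absorbs a K₄ or K₃,₃, because its
subgraph can be perturbed by one of five vectors (`exists_correction`), each of which some subgraph
of K₄, and one of K₃,₃, compensates. Exceptional components also balance one another, so stripping
pieces by induction (`Closed.reduced`) leaves only K₄, 3K₄ and K₃,₃. These fail because degrees 0
and 3 cannot both occur in a subgraph of K₄, and by a finite check for K₃,₃. -/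

namespace BalancedSubgraph

open Finset

variable {V : Type*}

/-! ### Single-edge changes and degree counts. -/

/-- Removing one edge. -/
def del (H : SimpleGraph V) (u v : V) : SimpleGraph V where
  Adj x y := H.Adj x y ∧ ¬ (x = u ∧ y = v) ∧ ¬ (x = v ∧ y = u)
  symm := ⟨fun _ _ h => ⟨h.1.symm, fun h' => h.2.2 ⟨h'.2, h'.1⟩, fun h' => h.2.1 ⟨h'.2, h'.1⟩⟩⟩
  loopless := ⟨fun x h => H.loopless.irrefl x h.1⟩

/-- Adding one edge. -/
def ins (H : SimpleGraph V) (u v : V) : SimpleGraph V where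
  Adj x y := H.Adj x y ∨ x ≠ y ∧ (x = u ∧ y = v ∨ x = v ∧ y = u)
  symm := ⟨fun _ _ h => h.elim (fun h => Or.inl h.symm) fun h =>
    Or.inr ⟨h.1.symm, h.2.symm.imp (fun h => ⟨h.2, h.1⟩) fun h => ⟨h.2, h.1⟩⟩⟩
  loopless := ⟨fun x h => h.elim (H.loopless.irrefl x) fun h => h.1 rfl⟩

theorem del_le {H G : SimpleGraph V} (h : H ≤ G) (u v : V) : del H u v ≤ G := fun _ _ h' => h h'.1

theorem ins_le {H G : SimpleGraph V} (h : H ≤ G) {u v : V} (huv : G.Adj u v) : ins H u v ≤ G := by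
  rintro x y (h' | ⟨-, ⟨rfl, rfl⟩ | ⟨rfl, rfl⟩⟩)
  · exact h h'
  · exact huv
  · exact huv.symm

theorem del_comm (H : SimpleGraph V) (u v : V) : del H u v = del H v u := by
  ext x y
  simp only [del]
  tauto

theorem ins_comm (H : SimpleGraph V) (u v : V) : ins H u v = ins H v u := by
  ext x y
  simp only [ins]
  tauto

/-- The change in the number of vertices of degree `k` when a degree goes from `i` to `j`. -/
def chg (i j k : ℕ) : ℤ := (if j = k then 1 else 0) - (if i = k then 1 else 0)

variable [Fintype V]

open Classical in
/-- The degree of `v` in `H`. -/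
noncomputable def dg (H : SimpleGraph V) (v : V) : ℕ := (univ.filter fun w => H.Adj v w).card

/-- The number of vertices of degree `k` in `H`. -/
noncomputable def cnt (H : SimpleGraph V) (k : ℕ) : ℕ := (univ.filter fun v => dg H v = k).card

theorem degreeCount_eq_cnt (H : SimpleGraph V) (k : ℕ) : degreeCount H k = cnt H k := by
  classical
  unfold degreeCount cnt dg
  congr 1
  ext v
  simp only [mem_filter, mem_univ, true_and]
  rw [← SimpleGraph.card_neighborFinset_eq_degree]
  have : (univ.filter fun w => H.Adj v w) = H.neighborFinset v := by
    ext w; simp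
  rw [← this]

theorem dg_mono {H G : SimpleGraph V} (h : H ≤ G) (v : V) : dg H v ≤ dg G v := by
  classical
  unfold dg
  refine card_le_card fun w hw => ?_
  simp only [mem_filter, mem_univ, true_and] at hw ⊢
  exact h hw

theorem sum_dg_even (H : SimpleGraph V) : Even (∑ v, dg H v) := by
  classical
  have h := H.sum_degrees_eq_twice_card_edges
  have h2 : ∀ v, dg H v = H.degree v := by
    intro v
    rw [← SimpleGraph.card_neighborFinset_eq_degree]
    unfold dg
    congr 1
    ext w; simp
  simp only [h2, h]
  exact even_two_mul _

theorem cnt_sum {H : SimpleGraph V} (h : ∀ v, dg H v ≤ 3) :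
    cnt H 0 + cnt H 1 + cnt H 2 + cnt H 3 = Fintype.card V := by
  classical
  have h1 := card_eq_sum_card_fiberwise (f := dg H) (s := univ) (t := range 4)
    (fun v _ => by simpa using Nat.lt_succ_of_le (h v))
  simp only [sum_range_succ, sum_range_zero, zero_add] at h1
  rw [← card_univ, h1]
  rfl

theorem sum_dg {H : SimpleGraph V} (h : ∀ v, dg H v ≤ 3) :
    ∑ v, dg H v = cnt H 1 + 2 * cnt H 2 + 3 * cnt H 3 := by
  classical
  have h1 := sum_fiberwise_of_maps_to (s := univ) (t := range 4) (g := dg H) (f := dg H)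
    (fun v _ => by simpa using Nat.lt_succ_of_le (h v))
  rw [← h1]
  have h2 : ∀ k, ∑ v ∈ univ.filter (fun v => dg H v = k), dg H v = k * cnt H k := by
    intro k
    rw [sum_congr rfl (g := fun _ => k) (by intro v hv; simpa using hv)]
    simp [cnt, mul_comm]
  simp only [sum_range_succ, sum_range_zero, h2]
  ring

theorem cnt_odd_even {H : SimpleGraph V} (h : ∀ v, dg H v ≤ 3) : Even (cnt H 1 + cnt H 3) := by
  have h1 := sum_dg_even H
  rw [sum_dg h] at h1
  rcases h1 with ⟨r, hr⟩
  exact ⟨r - cnt H 2 - cnt H 3, by omega⟩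

theorem exists_of_cnt_pos {H : SimpleGraph V} {k : ℕ} (h : 0 < cnt H k) : ∃ v, dg H v = k := by
  obtain ⟨v, hv⟩ := card_pos.1 h
  exact ⟨v, by simpa using hv⟩

theorem cnt_pos {H : SimpleGraph V} {k : ℕ} {v : V} (h : dg H v = k) : 0 < cnt H k :=
  card_pos.2 ⟨v, by simpa using h⟩

theorem exists_ne_of_one_lt_cnt {H : SimpleGraph V} {k : ℕ} (h : 1 < cnt H k) (u : V) :
    ∃ v, v ≠ u ∧ dg H v = k := by
  obtain ⟨v, hv, hvu⟩ := exists_mem_ne h u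
  exact ⟨v, hvu, by simpa using hv⟩

theorem exists_adj_of_dg_pos {H : SimpleGraph V} {v : V} (h : 0 < dg H v) : ∃ w, H.Adj v w := by
  classical
  obtain ⟨w, hw⟩ := card_pos.1 h
  exact ⟨w, by simpa using hw⟩

theorem dg_pos {H : SimpleGraph V} {v w : V} (h : H.Adj v w) : 0 < dg H v := by
  classical
  exact card_pos.2 ⟨w, by simpa using h⟩

theorem exists_adj_ne_of_one_lt_dg {H : SimpleGraph V} {v : V} (h : 1 < dg H v) (u : V) :
    ∃ w, H.Adj v w ∧ w ≠ u := by
  classical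
  obtain ⟨w, hw, hwu⟩ := exists_mem_ne h u
  exact ⟨w, by simpa using hw, hwu⟩

theorem eq_of_dg_eq_one {H : SimpleGraph V} {v a b : V} (h : dg H v = 1) (ha : H.Adj v a)
    (hb : H.Adj v b) : a = b := by
  classical
  obtain ⟨c, hc⟩ := card_eq_one.1 h
  have h1 : a ∈ ({c} : Finset V) := hc ▸ by simpa using ha
  have h2 : b ∈ ({c} : Finset V) := hc ▸ by simpa using hb
  simp only [mem_singleton] at h1 h2
  rw [h1, h2]

theorem dg_sdiff {H G : SimpleGraph V} (h : H ≤ G) (v : V) : dg H v + dg (G \ H) v = dg G v := by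
  classical
  unfold dg
  rw [← card_union_of_disjoint]
  · congr 1
    ext w
    simp only [mem_union, mem_filter, mem_univ, true_and, SimpleGraph.sdiff_adj]
    constructor
    · rintro (h1 | h1)
      · exact h h1
      · exact h1.1
    · intro h1
      by_cases h2 : H.Adj v w
      · exact Or.inl h2
      · exact Or.inr ⟨h1, h2⟩
  · rw [disjoint_left]
    intro w
    simp only [mem_filter, mem_univ, true_and, SimpleGraph.sdiff_adj]
    tauto

theorem adj_of_dg_eq {H G : SimpleGraph V} (h : H ≤ G) {v w : V} (hv : dg H v = dg G v)
    (hw : G.Adj v w) : H.Adj v w := by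
  by_contra hn
  have h1 := dg_sdiff h v
  have h2 : 0 < dg (G \ H) v := dg_pos (w := w) ⟨hw, hn⟩
  omega

theorem dg_del_left {H : SimpleGraph V} {u v : V} (h : H.Adj u v) :
    dg (del H u v) u + 1 = dg H u := by
  classical
  unfold dg
  have hne := h.ne
  have : (univ.filter fun w => (del H u v).Adj u w) = (univ.filter fun w => H.Adj u w).erase v := by
    ext w
    simp only [del, mem_filter, mem_univ, true_and, mem_erase]
    tauto
  rw [this, card_erase_of_mem (by simpa using h)]
  have := card_pos.2 ⟨v, (by simpa using h : v ∈ univ.filter fun w => H.Adj u w)⟩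
  omega

theorem dg_del_right {H : SimpleGraph V} {u v : V} (h : H.Adj u v) :
    dg (del H u v) v + 1 = dg H v := by
  rw [del_comm]; exact dg_del_left h.symm

theorem dg_del_of_ne {H : SimpleGraph V} {u v w : V} (hu : w ≠ u) (hv : w ≠ v) :
    dg (del H u v) w = dg H w := by
  classical
  unfold dg
  congr 1
  ext x
  simp only [mem_filter, mem_univ, true_and]
  simp only [del]
  tauto

theorem dg_ins_left {H : SimpleGraph V} {u v : V} (hne : u ≠ v) (h : ¬ H.Adj u v) :
    dg (ins H u v) u = dg H u + 1 := by
  classical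
  unfold dg
  have : (univ.filter fun w => (ins H u v).Adj u w) =
      insert v (univ.filter fun w => H.Adj u w) := by
    ext w
    simp only [ins, mem_filter, mem_univ, true_and, mem_insert]
    constructor
    · tauto
    · rintro (rfl | h')
      · tauto
      · tauto
  rw [this, card_insert_of_notMem (by simpa using h)]

theorem dg_ins_right {H : SimpleGraph V} {u v : V} (hne : u ≠ v) (h : ¬ H.Adj u v) :
    dg (ins H u v) v = dg H v + 1 := by
  rw [ins_comm]; exact dg_ins_left hne.symm fun h' => h h'.symm

theorem dg_ins_of_ne {H : SimpleGraph V} {u v w : V} (hu : w ≠ u) (hv : w ≠ v) :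
    dg (ins H u v) w = dg H w := by
  classical
  unfold dg
  congr 1
  ext x
  simp only [mem_filter, mem_univ, true_and]
  simp only [ins]
  tauto

theorem cnt_change {H H' : SimpleGraph V} {u v : V} (hne : u ≠ v)
    (h : ∀ w, w ≠ u → w ≠ v → dg H' w = dg H w) (k : ℕ) :
    (cnt H' k : ℤ) = cnt H k + chg (dg H u) (dg H' u) k + chg (dg H v) (dg H' v) k := by
  classical
  have key : ∀ K : SimpleGraph V, (cnt K k : ℤ) = (if dg K u = k then 1 else 0) +
      ((if dg K v = k then 1 else 0) +
      ∑ w ∈ (univ.erase u).erase v, if dg K w = k then (1 : ℤ) else 0) := by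
    intro K
    rw [add_sum_erase _ (fun w => if dg K w = k then (1 : ℤ) else 0)
      (by simpa using hne.symm : v ∈ univ.erase u),
      add_sum_erase _ (fun w => if dg K w = k then (1 : ℤ) else 0) (mem_univ u)]
    simp [cnt]
  rw [key H', key H, sum_congr rfl (g := fun w => if dg H w = k then (1 : ℤ) else 0)]
  · unfold chg; ring
  · intro w hw
    simp only [mem_erase, mem_univ, and_true] at hw
    rw [h w hw.2 hw.1]

/-- Effect on the degree counts of removing an edge whose ends have degrees `i` and `j`. -/
theorem vec_del {H : SimpleGraph V} {u v : V} {i j : ℕ} (h : H.Adj u v) (hu : dg H u = i)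
    (hv : dg H v = j) (k : ℕ) :
    (cnt (del H u v) k : ℤ) = cnt H k + chg i (i - 1) k + chg j (j - 1) k := by
  have h1 := dg_del_left h
  have h2 := dg_del_right h
  rw [cnt_change h.ne (fun w => dg_del_of_ne) k, hu, hv]
  congr 3 <;> omega

/-- Effect on the degree counts of adding an edge whose ends have degrees `i` and `j`. -/
theorem vec_ins {H : SimpleGraph V} {u v : V} {i j : ℕ} (hne : u ≠ v) (h : ¬ H.Adj u v)
    (hu : dg H u = i) (hv : dg H v = j) (k : ℕ) :
    (cnt (ins H u v) k : ℤ) = cnt H k + chg i (i + 1) k + chg j (j + 1) k := by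
  rw [cnt_change hne (fun w => dg_ins_of_ne) k, dg_ins_left hne h, dg_ins_right hne h, hu, hv]

end BalancedSubgraph

/-! ### Count shifts, double counting, extremal subgraphs. -/

namespace BalancedSubgraph

open Finset

theorem adj_del {V : Type*} {H : SimpleGraph V} {u v x y : V} :
    (del H u v).Adj x y ↔ H.Adj x y ∧ ¬ (x = u ∧ y = v) ∧ ¬ (x = v ∧ y = u) := Iff.rfl

theorem adj_ins {V : Type*} {H : SimpleGraph V} {u v x y : V} :
    (ins H u v).Adj x y ↔ H.Adj x y ∨ x ≠ y ∧ (x = u ∧ y = v ∨ x = v ∧ y = u) := Iff.rfl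

variable {V : Type*} [Fintype V]

-- Double counting of adjacent pairs in `S × T`. This turns restrictions on which degrees may be
-- adjacent into inequalities between counts.
open Classical in
theorem sum_le_sum_dg {H : SimpleGraph V} (S T : Finset V) (c : V → ℕ)
    (h : ∀ x ∈ S, c x ≤ (T.filter fun y => H.Adj x y).card) :
    ∑ x ∈ S, c x ≤ ∑ y ∈ T, dg H y := by
  calc ∑ x ∈ S, c x ≤ ∑ x ∈ S, (T.filter fun y => H.Adj x y).card := sum_le_sum h
    _ = ∑ y ∈ T, (S.filter fun x => H.Adj x y).card :=
        sum_card_bipartiteAbove_eq_sum_card_bipartiteBelow _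
    _ ≤ ∑ y ∈ T, dg H y := by
        refine sum_le_sum fun y _ => card_le_card fun x hx => ?_
        simp only [mem_filter, mem_univ, true_and] at hx ⊢
        exact hx.2.symm

theorem sum_dg_filter (H : SimpleGraph V) (k : ℕ) :
    ∑ v ∈ univ.filter (fun v => dg H v = k), dg H v = k * cnt H k := by
  rw [sum_congr rfl (g := fun _ => k) (by intro v hv; simpa using hv)]
  simp [cnt, mul_comm]

/-- If the vertices of degree three have too many half-edges, two of them are adjacent. -/
theorem exists_adj_three_three {H : SimpleGraph V} (h3 : ∀ v, dg H v ≤ 3)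
    (h : cnt H 1 + 2 * cnt H 2 < 3 * cnt H 3) :
    ∃ x y, H.Adj x y ∧ dg H x = 3 ∧ dg H y = 3 := by
  classical
  by_contra! hn
  have h1 := sum_le_sum_dg (H := H) (univ.filter fun v => dg H v = 3)
    (univ.filter fun v => ¬ dg H v = 3) (dg H) (by
      intro x hx
      simp only [mem_filter, mem_univ, true_and] at hx
      refine card_le_card fun y hy => ?_
      simp only [mem_filter, mem_univ, true_and] at hy ⊢
      exact ⟨hn x y hy hx, hy⟩)
  have h2 := sum_filter_add_sum_filter_not univ (fun v => dg H v = 3) (dg H)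
  rw [sum_dg h3, sum_dg_filter] at h2
  rw [sum_dg_filter] at h1
  omega

open Classical in
theorem dg_del_eq {H : SimpleGraph V} {u v : V} (h : H.Adj u v) (w : V) :
    dg (del H u v) w = if w = u ∨ w = v then dg H w - 1 else dg H w := by
  split_ifs with hw
  · rcases hw with rfl | rfl
    · have := dg_del_left h
      omega
    · have := dg_del_right h
      omega
  · exact dg_del_of_ne (fun h => hw (Or.inl h)) fun h => hw (Or.inr h)

open Classical in
theorem dg_ins_eq {H : SimpleGraph V} {u v : V} (hne : u ≠ v) (h : ¬ H.Adj u v) (w : V) :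
    dg (ins H u v) w = if w = u ∨ w = v then dg H w + 1 else dg H w := by
  split_ifs with hw
  · rcases hw with rfl | rfl
    · exact dg_ins_left hne h
    · exact dg_ins_right hne h
  · exact dg_ins_of_ne (fun h => hw (Or.inl h)) fun h => hw (Or.inr h)

/-- `H'` arises from `H` by adding `a`, `b`, `c`, `d` to the numbers of vertices of degrees
`0`, `1`, `2`, `3`. -/
def Shift (H H' : SimpleGraph V) (a b c d : ℤ) : Prop :=
  (cnt H' 0 : ℤ) = cnt H 0 + a ∧ (cnt H' 1 : ℤ) = cnt H 1 + b ∧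
    (cnt H' 2 : ℤ) = cnt H 2 + c ∧ (cnt H' 3 : ℤ) = cnt H 3 + d

theorem Shift.trans {H H' H'' : SimpleGraph V} {a b c d a' b' c' d' : ℤ}
    (h : Shift H H' a b c d) (h' : Shift H' H'' a' b' c' d') :
    Shift H H'' (a + a') (b + b') (c + c') (d + d') := by
  unfold Shift at *
  omega

theorem shift_del {H : SimpleGraph V} {u v : V} (h : H.Adj u v) {i j : ℕ} (hu : dg H u = i)
    (hv : dg H v = j) : Shift H (del H u v) (chg i (i - 1) 0 + chg j (j - 1) 0)
      (chg i (i - 1) 1 + chg j (j - 1) 1) (chg i (i - 1) 2 + chg j (j - 1) 2)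
      (chg i (i - 1) 3 + chg j (j - 1) 3) := by
  have h1 := fun k => vec_del h hu hv k
  refine ⟨?_, ?_, ?_, ?_⟩ <;> rw [h1] <;> ring

theorem shift_ins {H : SimpleGraph V} {u v : V} (hne : u ≠ v) (h : ¬ H.Adj u v) {i j : ℕ}
    (hu : dg H u = i) (hv : dg H v = j) :
    Shift H (ins H u v) (chg i (i + 1) 0 + chg j (j + 1) 0)
      (chg i (i + 1) 1 + chg j (j + 1) 1) (chg i (i + 1) 2 + chg j (j + 1) 2)
      (chg i (i + 1) 3 + chg j (j + 1) 3) := by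
  have h1 := fun k => vec_ins hne h hu hv k
  refine ⟨?_, ?_, ?_, ?_⟩ <;> rw [h1] <;> ring

/-- The only nonempty set of vertices closed under adjacency is the whole vertex set. -/
def Conn (G : SimpleGraph V) : Prop :=
  ∀ P : V → Prop, (∀ x y, P x → G.Adj x y → P y) → (∃ x, P x) → ∀ x, P x

/-- `H` is a spanning subgraph of the cubic graph `G` whose numbers of vertices of degrees
`0`, `1`, `2` are at most `q`, `p`, `q`, with the least number of edges possible. -/
structure Extremal (G H : SimpleGraph V) (q p : ℕ) : Prop where
  cubic : ∀ v, dg G v = 3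
  card : Fintype.card V = 2 * q + 2 * p
  le : H ≤ G
  zero_le : cnt H 0 ≤ q
  one_le : cnt H 1 ≤ p
  two_le : cnt H 2 ≤ q
  -- The weighted sum is the total of 3 - deg, that is 3n - 2e, so it is large exactly when edges
  -- are few.
  min : ∀ H' ≤ G, cnt H' 0 ≤ q → cnt H' 1 ≤ p → cnt H' 2 ≤ q →
    3 * cnt H' 0 + 2 * cnt H' 1 + cnt H' 2 ≤ 3 * cnt H 0 + 2 * cnt H 1 + cnt H 2

namespace Extremal

variable {G H H' : SimpleGraph V} {q p : ℕ}

theorem dg_le (E : Extremal G H q p) (v : V) : dg H v ≤ 3 := by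
  rw [← E.cubic v]; exact dg_mono E.le v

theorem sum_eq (E : Extremal G H q p) :
    cnt H 0 + cnt H 1 + cnt H 2 + cnt H 3 = 2 * q + 2 * p := by
  rw [← E.card, cnt_sum E.dg_le]

theorem even (E : Extremal G H q p) : (cnt H 1 + cnt H 3) % 2 = 0 :=
  Nat.even_iff.1 (cnt_odd_even E.dg_le)

/-- The form in which extremality is used: a modification that keeps the three bounds and has net
loss of edges cannot exist. -/
theorem absurd (E : Extremal G H q p) (hle : H' ≤ G) {a b c d : ℤ} (h : Shift H H' a b c d)
    (h' : cnt H 0 + a ≤ q ∧ cnt H 1 + b ≤ p ∧ cnt H 2 + c ≤ q ∧ 0 < 3 * a + 2 * b + c) :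
    False := by
  obtain ⟨h0, h1, h2, -⟩ := h
  have := E.min H' hle (by omega) (by omega) (by omega)
  omega

theorem of_shift (E : Extremal G H q p) (hle : H' ≤ G) (h : Shift H H' 0 0 0 0) :
    Extremal G H' q p := by
  obtain ⟨h0, h1, h2, -⟩ := h
  have h0' : cnt H' 0 = cnt H 0 := by omega
  have h1' : cnt H' 1 = cnt H 1 := by omega
  have h2' : cnt H' 2 = cnt H 2 := by omega
  refine ⟨E.cubic, E.card, hle, ?_, ?_, ?_, ?_⟩
  · rw [h0']; exact E.zero_le
  · rw [h1']; exact E.one_le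
  · rw [h2']; exact E.two_le
  · rw [h0', h1', h2']; exact E.min

theorem adj_of_three (E : Extremal G H q p) {v w : V} (hv : dg H v = 3) (h : G.Adj v w) :
    H.Adj v w := adj_of_dg_eq E.le (by rw [hv, E.cubic]) h

theorem dg_cases (E : Extremal G H q p) (v : V) :
    dg H v = 0 ∨ dg H v = 1 ∨ dg H v = 2 ∨ dg H v = 3 := by
  have := E.dg_le v
  omega

theorem dg_cases_of_adj (E : Extremal G H q p) {v w : V} (h : H.Adj v w) :
    dg H w = 1 ∨ dg H w = 2 ∨ dg H w = 3 := by
  have := E.dg_le w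
  have := dg_pos h.symm
  omega

/-- Some vertex of degree three has a neighbour of smaller degree. -/
theorem exists_three_adj_lt (E : Extremal G H q p) (hc : Conn G) {x v : V} (hx : dg H x = 3)
    (hv : dg H v ≠ 3) : ∃ x y, H.Adj x y ∧ dg H x = 3 ∧ (dg H y = 1 ∨ dg H y = 2) := by
  by_contra! hn
  refine hv (hc (fun v => dg H v = 3) (fun x y hx hxy => ?_) ⟨x, hx⟩ v)
  have h1 := E.adj_of_three hx hxy
  have h2 := hn x y h1 hx
  have h3 := E.dg_cases_of_adj h1
  omega

/-- Deleting an edge between two vertices of degree 3 adds (0,0,2,-2), so there is no room for two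
more vertices of degree 2. -/
theorem pred_le_two (E : Extremal G H q p) (hpq : q ≤ p) (h3 : p < cnt H 3) :
    q ≤ cnt H 2 + 1 := by
  by_contra! hn
  obtain ⟨x, y, hxy, hx, hy⟩ := exists_adj_three_three E.dg_le (by have := E.one_le; omega)
  have := E.zero_le
  have := E.one_le
  exact E.absurd (del_le E.le x y) (shift_del hxy hx hy) (by norm_num [chg]; omega)

/-- Edges of type 3–2 and 1–2 can be deleted, so vertices of degree 2 meet only their own kind.
Deleting a 2–2 edge creates two leaves; if there is room for only one, deleting a 3–1 edge as well
leaves the net change (1,1,-1,-1). -/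
theorem not_zero_lt_one_lt (E : Extremal G H q p) (hc : Conn G) (hq : 2 ≤ q) (hpq : q ≤ p)
    (h3 : p < cnt H 3) (h0 : cnt H 0 < q) (h1 : cnt H 1 < p) : False := by
  have hpre := E.pred_le_two hpq h3
  have := E.two_le
  have h23 : ∀ x y, H.Adj x y → dg H x = 3 → dg H y = 2 → False := fun x y h hx hy =>
    E.absurd (del_le E.le x y) (shift_del h hx hy) (by norm_num [chg]; omega)
  have h12 : ∀ x y, H.Adj x y → dg H x = 1 → dg H y = 2 → False := fun x y h hx hy =>
    E.absurd (del_le E.le x y) (shift_del h hx hy) (by norm_num [chg]; omega)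
  obtain ⟨w, hw⟩ := exists_of_cnt_pos (H := H) (k := 2) (by omega)
  obtain ⟨w', hww⟩ := exists_adj_of_dg_pos (H := H) (v := w) (by omega)
  have hw' : dg H w' = 2 := by
    rcases E.dg_cases_of_adj hww with h | h | h
    · exact (h12 w' w hww.symm h hw).elim
    · exact h
    · exact (h23 w' w hww.symm h hw).elim
  by_cases h1' : cnt H 1 + 1 < p
  · exact E.absurd (del_le E.le w w') (shift_del hww hw hw') (by norm_num [chg]; omega)
  obtain ⟨x, hx⟩ := exists_of_cnt_pos (H := H) (k := 3) (by omega)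
  obtain ⟨x, r, hxr, hx, hr | hr⟩ := E.exists_three_adj_lt hc hx (v := w) (by omega)
  · have hxr' : (del H w w').Adj x r := by grind [adj_del]
    exact E.absurd (del_le (del_le E.le w w') x r)
      ((shift_del hww hw hw').trans (shift_del hxr' (i := 3) (j := 1)
        (by grind [dg_del_eq]) (by grind [dg_del_eq])))
      (by norm_num [chg]; omega)
  · exact h23 x r hxr hx hr

end Extremal

end BalancedSubgraph

/-! ### Reduction to two possible count vectors. -/

namespace BalancedSubgraph

open Finset

variable {V : Type*} [Fintype V]

namespace Extremal

variable {G H H' : SimpleGraph V} {q p : ℕ}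

/-- Parity fixes the number of vertices of degree 2. With room for two more leaves, 2–2 and 2–3
edges are excluded, so all 2q half-edges at vertices of degree 2 would end at leaves, of which there
are too few. -/
theorem of_zero_eq (E : Extremal G H q p) (hq : 2 ≤ q) (hpq : q ≤ p) (hpq' : p ≤ q + 1)
    (h3 : p < cnt H 3) (h0 : cnt H 0 = q) (h1 : cnt H 1 < p) :
    cnt H 1 + 1 = p ∧ cnt H 2 = q := by
  classical
  have hpre := E.pred_le_two hpq h3
  have := E.two_le
  have := E.even
  have := E.sum_eq
  have h2 : cnt H 2 = q := by omega
  refine ⟨?_, h2⟩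
  by_contra h1'
  have h23 : ∀ x y, H.Adj x y → dg H x = 3 → dg H y = 2 → False := fun x y h hx hy =>
    E.absurd (del_le E.le x y) (shift_del h hx hy) (by norm_num [chg]; omega)
  have h22 : ∀ x y, H.Adj x y → dg H x = 2 → dg H y = 2 → False := fun x y h hx hy =>
    E.absurd (del_le E.le x y) (shift_del h hx hy) (by norm_num [chg]; omega)
  have hs := sum_le_sum_dg (H := H) (univ.filter fun v => dg H v = 2)
    (univ.filter fun v => dg H v = 1) (dg H) (by
      intro x hx
      simp only [mem_filter, mem_univ, true_and] at hx
      refine card_le_card fun y hy => ?_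
      simp only [mem_filter, mem_univ, true_and] at hy ⊢
      refine ⟨?_, hy⟩
      rcases E.dg_cases_of_adj hy with h | h | h
      · exact h
      · exact (h22 x y hy hx h).elim
      · exact (h23 y x hy.symm h hx).elim)
  rw [sum_dg_filter, sum_dg_filter] at hs
  omega

/-- With room for two more isolated vertices, the edge at any leaf can be deleted. -/
theorem of_one_eq (E : Extremal G H q p) (hq : 2 ≤ q) (hpq : q ≤ p)
    (h0 : cnt H 0 < q) (h1 : cnt H 1 = p) (h2 : cnt H 2 + 1 = q) :
    cnt H 0 + 1 = q := by
  by_contra h0'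
  obtain ⟨r, hr⟩ := exists_of_cnt_pos (H := H) (k := 1) (by omega)
  obtain ⟨x, hrx⟩ := exists_adj_of_dg_pos (H := H) (v := r) (by omega)
  rcases E.dg_cases_of_adj hrx with h | h | h <;>
  exact E.absurd (del_le E.le r x) (shift_del hrx hr h) (by norm_num [chg]; omega)

/-- Room for two more isolated vertices makes many deletions admissible. What survives is too
sparse: leaves hang on distinct vertices of degree 3, which are adjacent neither to each other nor
to vertices of degree 2. Counting edges then gives the contradiction. -/
theorem not_one_eq_two_eq (E : Extremal G H q p) (hq : 2 ≤ q) (hpq : q ≤ p)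
    (h0 : cnt H 0 + 2 ≤ q) (h1 : cnt H 1 = p) (h2 : cnt H 2 = q) : False := by
  classical
  have hsum := E.sum_eq
  have h12 : ∀ x y, H.Adj x y → dg H x = 1 → dg H y = 2 → False := fun x y h hx hy =>
    E.absurd (del_le E.le x y) (shift_del h hx hy) (by norm_num [chg]; omega)
  have h11 : ∀ x y, H.Adj x y → dg H x = 1 → dg H y = 1 → False := fun x y h hx hy =>
    E.absurd (del_le E.le x y) (shift_del h hx hy) (by norm_num [chg]; omega)
  have h13 : ∀ r x, H.Adj r x → dg H r = 1 → dg H x = 3 := by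
    intro r x h hr
    rcases E.dg_cases_of_adj h with h' | h' | h'
    · exact (h11 r x h hr h').elim
    · exact (h12 r x h hr h').elim
    · exact h'
  have h131 : ∀ r x s, H.Adj x r → H.Adj x s → dg H r = 1 → dg H s = 1 → r ≠ s → False := by
    intro r x s hr hs dr ds hne
    have dx := h13 r x hr.symm dr
    clear h12 h11 h13
    exact E.absurd (del_le (del_le E.le x r) x s) ((shift_del hr dx dr).trans
      (shift_del (i := 2) (j := 1) (by grind [adj_del]) (by grind [dg_del_eq])
        (by grind [dg_del_eq]))) (by norm_num [chg]; omega)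
  have h22 : ∀ x y, H.Adj x y → dg H x = 2 → dg H y = 2 → False := by
    intro u v huv hu hv
    obtain ⟨r, hr⟩ := exists_of_cnt_pos (H := H) (k := 1) (by omega)
    obtain ⟨s, hsr, hs⟩ := exists_ne_of_one_lt_cnt (H := H) (k := 1) (by omega) r
    obtain ⟨x, hrx⟩ := exists_adj_of_dg_pos (H := H) (v := r) (by omega)
    obtain ⟨y, hsy⟩ := exists_adj_of_dg_pos (H := H) (v := s) (by omega)
    have hx := h13 r x hrx hr
    have hy := h13 s y hsy hs
    have hxy : x ≠ y := by
      rintro rfl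
      exact h131 r x s hrx.symm hsy.symm hr hs hsr.symm
    clear h12 h11 h13 h131
    have d1 : (del H u v).Adj r x := by grind [adj_del]
    have e1 : dg (del H u v) r = 1 := by grind [dg_del_eq]
    have e2 : dg (del H u v) x = 3 := by grind [dg_del_eq]
    have e3 : dg (del H u v) s = 1 := by grind [dg_del_eq]
    have e4 : dg (del H u v) y = 3 := by grind [dg_del_eq]
    exact E.absurd (del_le (del_le (del_le E.le u v) r x) s y)
      (((shift_del huv hu hv).trans (shift_del d1 e1 e2)).trans
      (shift_del (i := 1) (j := 3) (by grind [adj_del]) (by grind [dg_del_eq])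
        (by grind [dg_del_eq]))) (by norm_num [chg]; omega)
  have h132 : ∀ r x w, H.Adj x r → H.Adj x w → dg H r = 1 → dg H w = 2 → False := by
    intro r x w hr hw dr dw
    have dx := h13 r x hr.symm dr
    obtain ⟨s, hsr, hs⟩ := exists_ne_of_one_lt_cnt (H := H) (k := 1) (by omega) r
    obtain ⟨y, hsy⟩ := exists_adj_of_dg_pos (H := H) (v := s) (by omega)
    have hy := h13 s y hsy hs
    have hxy : x ≠ y := by
      rintro rfl
      exact h131 r x s hr hsy.symm dr hs hsr.symm
    clear h12 h11 h13 h131 h22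
    have d1 : (del H x r).Adj x w := by grind [adj_del]
    have e1 : dg (del H x r) x = 2 := by grind [dg_del_eq]
    have e2 : dg (del H x r) w = 2 := by grind [dg_del_eq]
    have e3 : dg (del H x r) s = 1 := by grind [dg_del_eq]
    have e4 : dg (del H x r) y = 3 := by grind [dg_del_eq]
    exact E.absurd (del_le (del_le (del_le E.le x r) x w) s y)
      (((shift_del hr dx dr).trans (shift_del d1 e1 e2)).trans
      (shift_del (i := 1) (j := 3) (by grind [adj_del]) (by grind [dg_del_eq])
        (by grind [dg_del_eq]))) (by norm_num [chg]; omega)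
  have h1331 : ∀ r x y s, H.Adj x r → H.Adj x y → H.Adj y s → dg H r = 1 → dg H s = 1 →
      False := by
    intro r x y s hr hxy hs dr ds
    have dx := h13 r x hr.symm dr
    have dy := h13 s y hs.symm ds
    have hrs : r ≠ s := by
      rintro rfl
      exact hxy.ne (eq_of_dg_eq_one dr hr.symm hs.symm)
    clear h12 h11 h13 h131 h22 h132
    have d1 : (del H x y).Adj x r := by grind [adj_del]
    have e1 : dg (del H x y) x = 2 := by grind [dg_del_eq]
    have e2 : dg (del H x y) r = 1 := by grind [dg_del_eq]
    have e3 : dg (del H x y) s = 1 := by grind [dg_del_eq]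
    have e4 : dg (del H x y) y = 2 := by grind [dg_del_eq]
    have := hxy.ne
    exact E.absurd (del_le (del_le (del_le E.le x y) x r) y s)
      (((shift_del hxy dx dy).trans (shift_del d1 e1 e2)).trans
      (shift_del (i := 2) (j := 1) (by grind [adj_del]) (by grind [dg_del_eq])
        (by grind [dg_del_eq]))) (by norm_num [chg]; omega)
  -- the vertices of degree three with a neighbour of degree one
  set A : Finset V := univ.filter fun x => ∃ r, H.Adj x r ∧ dg H r = 1 with hA
  set T : Finset V := univ.filter fun x => dg H x = 3 with hT
  set S : Finset V := univ.filter fun x => dg H x = 2 with hS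
  have hAT : A ⊆ T := by
    intro x hx
    obtain ⟨r, hr, dr⟩ := (mem_filter.1 hx).2
    exact mem_filter.2 ⟨mem_univ _, h13 r x hr.symm dr⟩
  have hAS : Disjoint A S := by
    rw [disjoint_left]
    intro x hx hx'
    have := (mem_filter.1 (hAT hx)).2
    have := (mem_filter.1 hx').2
    omega
  have hAcard : p ≤ A.card := by
    rw [← h1]
    have hex : ∀ r, ∃ x, dg H r = 1 → H.Adj r x := by
      intro r
      by_cases h : dg H r = 1
      · obtain ⟨x, hx⟩ := exists_adj_of_dg_pos (H := H) (v := r) (by omega)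
        exact ⟨x, fun _ => hx⟩
      · exact ⟨r, fun h' => (h h').elim⟩
    choose f hf using hex
    refine card_le_card_of_injOn f ?_ ?_
    · intro r hr
      have dr : dg H r = 1 := by simpa using hr
      exact mem_filter.2 ⟨mem_univ _, r, (hf r dr).symm, dr⟩
    · intro r hr s hs hrs
      have dr : dg H r = 1 := by simpa using hr
      have ds : dg H s = 1 := by simpa using hs
      by_contra hne
      have h' := (hf s ds).symm
      rw [← hrs] at h'
      exact h131 r (f r) s (hf r dr).symm h' dr ds hne
  have hB : ∀ x ∈ A, ∀ y, H.Adj x y → dg H y ≠ 1 → y ∈ T \ A := by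
    intro x hx y hxy hy
    obtain ⟨r, hr, dr⟩ := (mem_filter.1 hx).2
    rw [mem_sdiff]
    constructor
    · refine mem_filter.2 ⟨mem_univ _, ?_⟩
      rcases E.dg_cases_of_adj hxy with h | h | h
      · exact (hy h).elim
      · exact (h132 r x y hr hxy dr h).elim
      · exact h
    · intro hyA
      obtain ⟨s, hs, ds⟩ := (mem_filter.1 hyA).2
      exact h1331 r x y s hr hxy hs dr ds
  -- Each vertex of `A` or `S` sends at least two edges into `T \ A`, so 2(|A| + q) ≤ 3(|T| - |A|).
  -- As |A| ≥ p and |T| ≤ p + q, this yields 2p ≤ q.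
  have hkey := sum_le_sum_dg (H := H) (A ∪ S) (T \ A) (fun _ => 2) (by
    intro x hx
    rcases mem_union.1 hx with hx | hx
    · obtain ⟨r, hr, dr⟩ := (mem_filter.1 hx).2
      have dx : dg H x = 3 := (mem_filter.1 (hAT hx)).2
      have : (univ.filter fun y => H.Adj x y).erase r ⊆ (T \ A).filter fun y => H.Adj x y := by
        intro y hy
        simp only [mem_erase, mem_filter, mem_univ, true_and] at hy
        refine mem_filter.2 ⟨hB x hx y hy.2 fun dy => ?_, hy.2⟩
        exact h131 y x r hy.2 hr dy dr hy.1
      refine le_trans ?_ (card_le_card this)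
      rw [card_erase_of_mem (by simpa using hr)]
      change 2 ≤ dg H x - 1
      omega
    · have dx : dg H x = 2 := (mem_filter.1 hx).2
      rw [← dx]
      refine card_le_card fun y hy => ?_
      have hy : H.Adj x y := by simpa using hy
      refine mem_filter.2 ⟨?_, hy⟩
      rw [mem_sdiff]
      constructor
      · refine mem_filter.2 ⟨mem_univ _, ?_⟩
        rcases E.dg_cases_of_adj hy with h | h | h
        · exact (h12 y x hy.symm h dx).elim
        · exact (h22 x y hy dx h).elim
        · exact h
      · intro hyA
        obtain ⟨s, hs, ds⟩ := (mem_filter.1 hyA).2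
        exact h132 s y x hs hy.symm ds dx)
  rw [sum_const, card_union_of_disjoint hAS,
    sum_congr rfl (g := fun _ => 3) (fun y hy => (mem_filter.1 (mem_sdiff.1 hy).1).2),
    sum_const, card_sdiff_of_subset hAT] at hkey
  have hTc : T.card = cnt H 3 := rfl
  have hSc : S.card = cnt H 2 := rfl
  simp only [smul_eq_mul] at hkey
  omega

/-- The two possible count vectors of an extremal subgraph that misses the target. -/
theorem cases_of_lt (E : Extremal G H q p) (hc : Conn G) (hq : 2 ≤ q) (hpq : q ≤ p)
    (hpq' : p ≤ q + 1) (h3 : p < cnt H 3) :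
    (cnt H 0 = q ∧ cnt H 1 + 1 = p ∧ cnt H 2 = q) ∨
    (cnt H 0 + 1 = q ∧ cnt H 1 = p ∧ cnt H 2 + 1 = q) := by
  have hpre := E.pred_le_two hpq h3
  have := E.sum_eq
  have := E.even
  have := E.zero_le
  have := E.one_le
  have := E.two_le
  by_cases h1 : cnt H 1 < p
  · by_cases h0 : cnt H 0 < q
    · exact (E.not_zero_lt_one_lt hc hq hpq h3 h0 h1).elim
    · have := E.of_zero_eq hq hpq hpq' h3 (by omega) h1
      omega
  · by_cases h2 : cnt H 2 = q
    · exact (E.not_one_eq_two_eq hq hpq (by omega) (by omega) h2).elim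
    · have := E.of_one_eq hq hpq (by omega) (by omega) (by omega)
      omega

end Extremal

end BalancedSubgraph

/-! ### Excluding the two remaining vectors; connected graphs. -/

namespace BalancedSubgraph

open Finset

variable {V : Type*} [Fintype V]

namespace Extremal

variable {G H H' : SimpleGraph V} {q p : ℕ}

/-- In an extremal subgraph with counts `q - 1`, `p`, `q - 1`, a vertex of degree one can only
be joined to vertices of degree at most one, and moving its edge along an edge of `G` gives a
further extremal subgraph. -/
theorem slide (E : Extremal G H q p) (hc : Conn G) (hpq : q ≤ p)
    (h0 : cnt H 0 + 1 = q) (h1 : cnt H 1 = p) (h2 : cnt H 2 + 1 = q)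
    {r t : V} (hr : dg H r = 1) (hrt : G.Adj r t) :
    dg H t = 1 ∨ dg H t = 0 ∧ ∃ H', Extremal G H' q p ∧ Shift H H' 0 0 0 0 ∧ dg H' t = 1 ∧
      ∀ u, 2 ≤ dg H u → dg H' u = dg H u := by
  have hsum := E.sum_eq
  have h12 : ∀ x y, H.Adj x y → dg H x = 1 → dg H y = 2 → False := fun x y h hx hy =>
    E.absurd (del_le E.le x y) (shift_del h hx hy) (by norm_num [chg]; omega)
  have h13 : ∀ x y, H.Adj x y → dg H x = 1 → dg H y = 3 → False := fun x y h hx hy =>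
    E.absurd (del_le E.le x y) (shift_del h hx hy) (by norm_num [chg]; omega)
  obtain ⟨x, y, hxy, hx, hy⟩ := exists_adj_three_three E.dg_le (by omega)
  have h22 : ∀ x w, H.Adj x w → dg H x = 3 → dg H w = 2 →
      ∃ w', H.Adj w w' ∧ dg H w' = 2 := by
    intro x w hxw hx hw
    obtain ⟨y, hwy, hyx⟩ := exists_adj_ne_of_one_lt_dg (H := H) (v := w) (by omega) x
    refine ⟨y, hwy, ?_⟩
    rcases E.dg_cases_of_adj hwy with h | h | h
    · exact (h12 y w hwy.symm h hw).elim
    · exact h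
    · clear h12 h13
      have d1 : (del H x w).Adj w y := by grind [adj_del]
      exact (E.absurd (del_le (del_le E.le x w) w y) ((shift_del hxw hx hw).trans
        (shift_del d1 (i := 1) (j := 3) (by grind [dg_del_eq]) (by grind [dg_del_eq])))
        (by norm_num [chg]; omega)).elim
  obtain ⟨r', hrr⟩ := exists_adj_of_dg_pos (H := H) (v := r) (by omega)
  have hr' : dg H r' = 1 := by
    rcases E.dg_cases_of_adj hrr with h | h | h
    · exact h
    · exact (h12 r r' hrr hr h).elim
    · exact (h13 r r' hrr hr h).elim
  by_cases hHrt : H.Adj r t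
  · left
    rw [eq_of_dg_eq_one hr hHrt hrr]
    exact hr'
  have hne := hrt.ne
  have hrr' := hrr.ne
  have hxy' := hxy.ne
  have htr' : t ≠ r' := fun h => hHrt (h ▸ hrr)
  rcases E.dg_cases t with ht | ht | ht | ht
  · right
    refine ⟨ht, ?_⟩
    clear h12 h13 h22
    have d1 : ¬ (del H r r').Adj r t := by grind [adj_del]
    have s := (shift_del hrr hr hr').trans
      (shift_ins hne d1 (i := 0) (j := 0) (by grind [dg_del_eq]) (by grind [dg_del_eq]))
    refine ⟨_, E.of_shift (ins_le (del_le E.le r r') hrt) ?_, ?_, ?_, ?_⟩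
    · simpa [chg] using s
    · simpa [chg] using s
    · grind [dg_ins_eq, dg_del_eq]
    · grind [dg_ins_eq, dg_del_eq]
  -- Adding `rt` and deleting `rr'`, `ww'`, `xy` changes the counts by (1,0,1,-2), which hits the
  -- target.
  · exfalso
    obtain ⟨z, w, hzw, hz, hw | hw⟩ := E.exists_three_adj_lt hc hx (v := r) (by omega)
    · exact h13 w z hzw.symm hw hz
    obtain ⟨w', hww, hw'⟩ := h22 z w hzw hz hw
    have hww' := hww.ne
    clear h12 h13 h22
    have d1 : (ins H r t).Adj r r' := by grind [adj_ins]
    have d2 : (del (ins H r t) r r').Adj w w' := by grind [adj_ins, adj_del]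
    have d3 : (del (del (ins H r t) r r') w w').Adj x y := by grind [adj_ins, adj_del]
    have e1 : dg (ins H r t) r = 2 := by grind [dg_ins_eq]
    have e2 : dg (ins H r t) r' = 1 := by grind [dg_ins_eq]
    have e3 : dg (del (ins H r t) r r') w = 2 := by grind [dg_ins_eq, dg_del_eq]
    have e4 : dg (del (ins H r t) r r') w' = 2 := by grind [dg_ins_eq, dg_del_eq]
    have e5 : dg (del (del (ins H r t) r r') w w') x = 3 := by grind [dg_ins_eq, dg_del_eq]
    have e60 : dg (ins H r t) y = 3 := by grind [dg_ins_eq]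
    have e6 : dg (del (del (ins H r t) r r') w w') y = 3 := by grind [dg_ins_eq, dg_del_eq]
    exact E.absurd (del_le (del_le (del_le (ins_le E.le hrt) r r') w w') x y)
      ((((shift_ins hne hHrt hr ht).trans (shift_del d1 e1 e2)).trans
        (shift_del d2 e3 e4)).trans (shift_del d3 e5 e6)) (by norm_num [chg]; omega)
  -- Adding `rt` and deleting `rr'`, `ts`, `xy` again gives the net change (1,0,1,-2).
  · exfalso
    obtain ⟨s, hts, hs⟩ : ∃ s, H.Adj t s ∧ dg H s = 2 := by
      obtain ⟨s, hts⟩ := exists_adj_of_dg_pos (H := H) (v := t) (by omega)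
      rcases E.dg_cases_of_adj hts with h | h | h
      · exact (h12 s t hts.symm h ht).elim
      · exact ⟨s, hts, h⟩
      · exact h22 s t hts.symm h ht
    have hts' := hts.ne
    clear h12 h13 h22
    have d1 : (ins H r t).Adj r r' := by grind [adj_ins]
    have d2 : (del (ins H r t) r r').Adj t s := by grind [adj_ins, adj_del]
    have d3 : (del (del (ins H r t) r r') t s).Adj x y := by grind [adj_ins, adj_del]
    have e1 : dg (ins H r t) r = 2 := by grind [dg_ins_eq]
    have e2 : dg (ins H r t) r' = 1 := by grind [dg_ins_eq]
    have e3 : dg (del (ins H r t) r r') t = 3 := by grind [dg_ins_eq, dg_del_eq]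
    have e4 : dg (del (ins H r t) r r') s = 2 := by grind [dg_ins_eq, dg_del_eq]
    have e5 : dg (del (del (ins H r t) r r') t s) x = 3 := by grind [dg_ins_eq, dg_del_eq]
    have e60 : dg (ins H r t) y = 3 := by grind [dg_ins_eq]
    have e6 : dg (del (del (ins H r t) r r') t s) y = 3 := by grind [dg_ins_eq, dg_del_eq]
    exact E.absurd (del_le (del_le (del_le (ins_le E.le hrt) r r') t s) x y)
      ((((shift_ins hne hHrt hr ht).trans (shift_del d1 e1 e2)).trans
        (shift_del d2 e3 e4)).trans (shift_del d3 e5 e6)) (by norm_num [chg]; omega)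
  · exact (hHrt (E.adj_of_three ht hrt.symm).symm).elim

theorem not_pred_pred (E : Extremal G H q p) (hc : Conn G) (hq : 2 ≤ q) (hpq : q ≤ p)
    (h0 : cnt H 0 + 1 = q) (h1 : cnt H 1 = p) (h2 : cnt H 2 + 1 = q) : False := by
  have hsum := E.sum_eq
  obtain ⟨r, hr⟩ := exists_of_cnt_pos (H := H) (k := 1) (by omega)
  obtain ⟨v, hv⟩ := exists_of_cnt_pos (H := H) (k := 3) (by omega)
  -- By `slide`, being a leaf of some extremal subgraph with the same counts and the same degrees at
  -- every vertex of degree at least 2 in `H` spreads along edges of `G`. It therefore reaches `v`,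
  -- whose degree stays 3.
  obtain ⟨H', -, -, h', hv'⟩ := hc (fun v => ∃ H', Extremal G H' q p ∧ Shift H H' 0 0 0 0 ∧
    dg H' v = 1 ∧ ∀ u, 2 ≤ dg H u → dg H' u = dg H u) (by
      rintro x y ⟨H', E', hs, hx, hu⟩ hxy
      have hs' := hs
      obtain ⟨s0, s1, s2, -⟩ := hs'
      rcases E'.slide hc hpq (by omega) (by omega) (by omega) hx hxy with
        h | ⟨-, H'', E'', hs'', hy, hu'⟩
      · exact ⟨H', E', hs, h, hu⟩
      · refine ⟨H'', E'', by simpa using hs.trans hs'', hy, fun u h => ?_⟩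
        rw [hu' u (by rw [hu u h]; exact h), hu u h])
    ⟨r, H, E, by simp [Shift], hr, fun _ _ => rfl⟩ v
  rw [hv' v (by omega)] at h'
  omega

/-- For `p = q + 1`, if the alternative target is also missed. -/
theorem not_eq_pred_eq_of_succ (E : Extremal G H q (q + 1)) (hc : Conn G) (hq : 2 ≤ q)
    (hT : ∀ H' ≤ G, cnt H' 0 = q + 1 → cnt H' 1 = q → cnt H' 2 = q + 1 → False)
    (h0 : cnt H 0 = q) (h1 : cnt H 1 = q) (h2 : cnt H 2 = q) : False := by
  have hsum := E.sum_eq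
  obtain ⟨x, y, hxy, hx, hy⟩ := exists_adj_three_three E.dg_le (by omega)
  have h23 : ∀ x y, H.Adj x y → dg H x = 3 → dg H y = 2 → False := fun x y h hx hy =>
    E.absurd (del_le E.le x y) (shift_del h hx hy) (by norm_num [chg]; omega)
  obtain ⟨w, hw⟩ := exists_of_cnt_pos (H := H) (k := 2) (by omega)
  -- This set is closed: if `x` in it had a leaf `y`, deleting `xu` and `xy` would give
  -- (q+1,q,q+1,q), which `hT` forbids.
  obtain ⟨hw', -⟩ := hc (fun v => dg H v = 3 ∧ ∃ u, H.Adj v u ∧ dg H u = 3) (by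
    rintro x y ⟨hx, u, hxu, hu⟩ hxy
    have hxy := E.adj_of_three hx hxy
    refine ⟨?_, x, hxy.symm, hx⟩
    rcases E.dg_cases_of_adj hxy with h | h | h
    · exfalso
      clear h23
      have := hxu.ne
      have d1 : (del H x u).Adj x y := by grind [adj_del]
      have s := (shift_del hxu hx hu).trans
        (shift_del d1 (i := 2) (j := 1) (by grind [dg_del_eq]) (by grind [dg_del_eq]))
      have hle := del_le (del_le E.le x u) x y
      norm_num [chg, Shift] at s
      exact hT _ hle (by omega) (by omega) (by omega)
    · exact (h23 x y hxy hx h).elim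
    · exact h) ⟨x, hx, y, hxy, hy⟩ w
  omega

/-- Every exchange below has net change (0,1,0,-1), exactly what separates (q,q-1,q,q+1) from the
target. The cases follow the degree of the vertex at the far end of the `G`-edge missing at a vertex
of degree 2. -/
theorem not_eq_pred_eq (E : Extremal G H q q) (hc : Conn G) (hq : 2 ≤ q)
    (h0 : cnt H 0 = q) (h1 : cnt H 1 + 1 = q) (h2 : cnt H 2 = q) : False := by
  classical
  have hsum := E.sum_eq
  obtain ⟨a, b, hab, ha, hb⟩ := exists_adj_three_three E.dg_le (by omega)
  have hab' := hab.ne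
  have h23 : ∀ x y, H.Adj x y → dg H x = 3 → dg H y = 2 → False := fun x y h hx hy =>
    E.absurd (del_le E.le x y) (shift_del h hx hy) (by norm_num [chg]; omega)
  obtain ⟨w₀, hw₀⟩ := exists_of_cnt_pos (H := H) (k := 2) (by omega)
  obtain ⟨z, r₀, hzr, hz, hr₀⟩ : ∃ z r, H.Adj z r ∧ dg H z = 3 ∧ dg H r = 1 := by
    obtain ⟨z, w, hzw, hz, hw | hw⟩ := E.exists_three_adj_lt hc ha (v := w₀) (by omega)
    · exact ⟨z, w, hzw, hz, hw⟩
    · exact (h23 z w hzw hz hw).elim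
  -- a vertex of degree three all of whose neighbours have degree three
  obtain ⟨x, hx, hx3⟩ : ∃ x, dg H x = 3 ∧ ∀ y, H.Adj x y → dg H y = 3 := by
    by_contra! hn
    have hs := sum_le_sum_dg (H := H) (univ.filter fun v => dg H v = 3)
      (univ.filter fun v => dg H v = 1) (fun _ => 1) (by
        intro x hx
        have hx : dg H x = 3 := by simpa using hx
        obtain ⟨y, hxy, hy⟩ := hn x hx
        refine card_pos.2 ⟨y, ?_⟩
        simp only [mem_filter, mem_univ, true_and]
        refine ⟨?_, hxy⟩
        rcases E.dg_cases_of_adj hxy with h | h | h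
        · exact h
        · exact (h23 x y hxy hx h).elim
        · exact (hy h).elim)
    rw [sum_dg_filter, sum_const] at hs
    change cnt H 3 • 1 ≤ _ at hs
    simp only [smul_eq_mul] at hs
    omega
  obtain ⟨y, hxy⟩ := exists_adj_of_dg_pos (H := H) (v := x) (by omega)
  obtain ⟨z', hxz, hzy⟩ := exists_adj_ne_of_one_lt_dg (H := H) (v := x) (by omega) y
  have hy := hx3 y hxy
  have hz' := hx3 z' hxz
  have hxy' := hxy.ne
  have hxz' := hxz.ne
  have n22 : ∀ u v, G.Adj u v → ¬ H.Adj u v → dg H u = 2 → dg H v = 2 → False := by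
    intro u v huv hn hu hv
    clear h23 hx3
    have huv' := huv.ne
    have d1 : (del H x y).Adj x z' := by grind [adj_del]
    have e1 : dg (del H x y) x = 2 := by grind [dg_del_eq]
    have e2 : dg (del H x y) z' = 3 := by grind [dg_del_eq]
    have d2 : ¬ (del (del H x y) x z').Adj u v := by grind [adj_del]
    have e3 : dg (del (del H x y) x z') u = 2 := by grind [dg_del_eq]
    have e4 : dg (del (del H x y) x z') v = 2 := by grind [dg_del_eq]
    exact E.absurd (ins_le (del_le (del_le E.le x y) x z') huv)
      (((shift_del hxy hx hy).trans (shift_del d1 e1 e2)).trans (shift_ins huv' d2 e3 e4))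
      (by norm_num [chg]; omega)
  have nonadj : ∀ w, dg H w = 2 → ∃ u, G.Adj w u ∧ ¬ H.Adj w u := by
    intro w hw
    have := dg_sdiff E.le w
    rw [E.cubic, hw] at this
    obtain ⟨u, hu⟩ := exists_adj_of_dg_pos (H := G \ H) (v := w) (by omega)
    exact ⟨u, hu⟩
  by_cases n12 : ∃ w r, G.Adj w r ∧ ¬ H.Adj w r ∧ dg H w = 2 ∧ dg H r = 1
  · obtain ⟨w, r, hwr, hn, hw, hr⟩ := n12
    have hwr' := hwr.ne
    have h22 : ∀ u v, H.Adj u v → u ≠ w → v ≠ w → dg H u = 2 → dg H v = 2 → False := by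
      intro u v huv huw hvw hu hv
      clear h23 hx3 n22 nonadj
      have huv' := huv.ne
      have d1 : (del H u v).Adj a b := by grind [adj_del]
      have e1 : dg (del H u v) a = 3 := by grind [dg_del_eq]
      have e2 : dg (del H u v) b = 3 := by grind [dg_del_eq]
      have d2 : ¬ (del (del H u v) a b).Adj w r := by grind [adj_del]
      have e3 : dg (del (del H u v) a b) w = 2 := by grind [dg_del_eq]
      have e4 : dg (del (del H u v) a b) r = 1 := by grind [dg_del_eq]
      exact E.absurd (ins_le (del_le (del_le E.le u v) a b) hwr)
        (((shift_del huv hu hv).trans (shift_del d1 e1 e2)).trans (shift_ins hwr' d2 e3 e4))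
        (by norm_num [chg]; omega)
    -- Each vertex of degree 2 other than `w` has a leaf neighbour. That leaf is never `r₀`, whose
    -- only neighbour has degree 3, so q - 1 ≤ q - 2.
    have hs := sum_le_sum_dg (H := H) ((univ.filter fun v => dg H v = 2).erase w)
      ((univ.filter fun v => dg H v = 1).erase r₀) (fun _ => 1) (by
        intro u hu
        obtain ⟨huw, hu⟩ := mem_erase.1 hu
        have hu : dg H u = 2 := by simpa using hu
        obtain ⟨v, huv, hvw⟩ := exists_adj_ne_of_one_lt_dg (H := H) (v := u) (by omega) w
        refine card_pos.2 ⟨v, ?_⟩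
        simp only [mem_filter, mem_univ, true_and, mem_erase]
        refine ⟨⟨?_, ?_⟩, huv⟩
        · rintro rfl
          have := eq_of_dg_eq_one hr₀ hzr.symm huv.symm
          subst this
          omega
        · rcases E.dg_cases_of_adj huv with h | h | h
          · exact h
          · exact (h22 u v huv huw hvw hu h).elim
          · exact (h23 v u huv.symm h hu).elim)
    rw [sum_congr rfl (g := fun _ => 1) (s₁ := (univ.filter fun v => dg H v = 1).erase r₀) (by
        intro v hv
        simpa using (mem_erase.1 hv).2), sum_const, sum_const,
      card_erase_of_mem (by simpa using hw), card_erase_of_mem (by simpa using hr₀)] at hs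
    change (cnt H 2 - 1) • 1 ≤ (cnt H 1 - 1) • 1 at hs
    simp only [smul_eq_mul] at hs
    have := cnt_pos hr₀
    omega
  · have n20 : ∀ w, dg H w = 2 → ∃ u, G.Adj w u ∧ ¬ H.Adj w u ∧ dg H u = 0 := by
      intro w hw
      obtain ⟨u, hwu, hn⟩ := nonadj w hw
      refine ⟨u, hwu, hn, ?_⟩
      rcases E.dg_cases u with h | h | h | h
      · exact h
      · exact (n12 ⟨w, u, hwu, hn, hw, h⟩).elim
      · exact (n22 w u hwu hn hw h).elim
      · exact (hn (E.adj_of_three h hwu.symm).symm).elim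
    clear n12
    by_cases e12 : ∃ r w, H.Adj r w ∧ dg H r = 1 ∧ dg H w = 2
    · obtain ⟨r, w, hrw, hr, hw⟩ := e12
      obtain ⟨w', hww, hw'⟩ := exists_ne_of_one_lt_cnt (H := H) (k := 2) (by omega) w
      obtain ⟨u, hwu, hn, hu⟩ := n20 w' hw'
      clear h23 hx3 n22 nonadj n20
      have d1 : (del H r w).Adj a b := by grind [adj_del]
      have e1 : dg (del H r w) a = 3 := by grind [dg_del_eq]
      have e2 : dg (del H r w) b = 3 := by grind [dg_del_eq]
      have d2 : ¬ (del (del H r w) a b).Adj w' u := by grind [adj_del]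
      have e3 : dg (del (del H r w) a b) w' = 2 := by grind [dg_del_eq]
      have e4 : dg (del (del H r w) a b) u = 0 := by grind [dg_del_eq]
      exact E.absurd (ins_le (del_le (del_le E.le r w) a b) hwu)
        (((shift_del hrw hr hw).trans (shift_del d1 e1 e2)).trans
          (shift_ins hwu.ne d2 e3 e4)) (by norm_num [chg]; omega)
    · obtain ⟨w', hww⟩ := exists_adj_of_dg_pos (H := H) (v := w₀) (by omega)
      have hw' : dg H w' = 2 := by
        rcases E.dg_cases_of_adj hww with h | h | h
        · exact (e12 ⟨w', w₀, hww.symm, h, hw₀⟩).elim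
        · exact h
        · exact (h23 w' w₀ hww.symm h hw₀).elim
      obtain ⟨u, hwu, hn, hu⟩ := n20 w₀ hw₀
      clear h23 hx3 n22 nonadj n20 e12
      have hww' := hww.ne
      have d1 : (del H w₀ w').Adj z r₀ := by grind [adj_del]
      have e1 : dg (del H w₀ w') z = 3 := by grind [dg_del_eq]
      have e2 : dg (del H w₀ w') r₀ = 1 := by grind [dg_del_eq]
      have d2 : ¬ (del (del H w₀ w') z r₀).Adj w₀ u := by grind [adj_del]
      have e3 : dg (del (del H w₀ w') z r₀) w₀ = 1 := by grind [dg_del_eq]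
      have e4 : dg (del (del H w₀ w') z r₀) u = 0 := by grind [dg_del_eq]
      exact E.absurd (ins_le (del_le (del_le E.le w₀ w') z r₀) hwu)
        (((shift_del hww hw₀ hw').trans (shift_del d1 e1 e2)).trans
          (shift_ins hwu.ne d2 e3 e4)) (by norm_num [chg]; omega)

end Extremal

theorem exists_extremal {G : SimpleGraph V} {q p : ℕ} (hG : ∀ v, dg G v = 3)
    (hcard : Fintype.card V = 2 * q + 2 * p) : ∃ H, Extremal G H q p := by
  classical
  let F : Finset (SimpleGraph V) :=
    univ.filter fun H => H ≤ G ∧ cnt H 0 ≤ q ∧ cnt H 1 ≤ p ∧ cnt H 2 ≤ q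
  have hcnt : ∀ k, k ≠ 3 → cnt G k = 0 := by
    intro k hk
    refine card_eq_zero.2 (filter_eq_empty_iff.2 fun v _ => ?_)
    rw [hG]
    exact hk.symm
  -- `G` itself is admissible: its counts in degrees 0, 1, 2 vanish.
  have hne : F.Nonempty := ⟨G, by
    refine mem_filter.2 ⟨mem_univ _, le_rfl, ?_, ?_, ?_⟩ <;> rw [hcnt] <;> omega⟩
  obtain ⟨H, hH, hmax⟩ := F.exists_max_image
    (fun H => 3 * cnt H 0 + 2 * cnt H 1 + cnt H 2) hne
  obtain ⟨hle, h0, h1, h2⟩ := (mem_filter.1 hH).2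
  exact ⟨H, hG, hcard, hle, h0, h1, h2, fun H' hle' h0' h1' h2' =>
    hmax H' (mem_filter.2 ⟨mem_univ _, hle', h0', h1', h2'⟩)⟩

theorem exists_balanced_of_conn {G : SimpleGraph V} {q : ℕ} (hG : ∀ v, dg G v = 3)
    (hc : Conn G) (hq : 2 ≤ q) (hcard : Fintype.card V = 4 * q) :
    ∃ H ≤ G, cnt H 0 = q ∧ cnt H 1 = q ∧ cnt H 2 = q ∧ cnt H 3 = q := by
  obtain ⟨H, E⟩ := exists_extremal (q := q) (p := q) hG (by omega)
  have := E.sum_eq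
  have := E.zero_le
  have := E.one_le
  have := E.two_le
  by_cases h3 : q < cnt H 3
  · rcases E.cases_of_lt hc hq le_rfl (by omega) h3 with ⟨h0, h1, h2⟩ | ⟨h0, h1, h2⟩
    · exact (E.not_eq_pred_eq hc hq h0 h1 h2).elim
    · exact (E.not_pred_pred hc hq le_rfl h0 h1 h2).elim
  · exact ⟨H, E.le, by omega, by omega, by omega, by omega⟩

theorem exists_balanced_of_conn' {G : SimpleGraph V} {q : ℕ} (hG : ∀ v, dg G v = 3)
    (hc : Conn G) (hq : 2 ≤ q) (hcard : Fintype.card V = 4 * q + 2) :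
    ∃ H ≤ G, cnt H 0 = q ∧ cnt H 1 = q + 1 ∧ cnt H 2 = q ∧ cnt H 3 = q + 1 ∨
      cnt H 0 = q + 1 ∧ cnt H 1 = q ∧ cnt H 2 = q + 1 ∧ cnt H 3 = q := by
  by_contra! hn
  obtain ⟨H, E⟩ := exists_extremal (q := q) (p := q + 1) hG (by omega)
  have := E.sum_eq
  have := E.zero_le
  have := E.one_le
  have := E.two_le
  have h3 : q + 1 < cnt H 3 := by
    by_contra h3
    exact (hn H E.le).1 (by omega) (by omega) (by omega) (by omega)
  rcases E.cases_of_lt hc hq (by omega) (by omega) h3 with ⟨h0, h1, h2⟩ | ⟨h0, h1, h2⟩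
  · refine E.not_eq_pred_eq_of_succ hc hq (fun H' hle h0 h1 h2 => ?_) h0 (by omega) h2
    have := cnt_sum (H := H') fun v => by rw [← hG v]; exact dg_mono hle v
    exact (hn H' hle).2 h0 h1 h2 (by omega)
  · exact E.not_pred_pred hc hq (by omega) h0 h1 h2

end BalancedSubgraph

/-! ### Perturbing a balanced subgraph of a connected graph. -/

namespace BalancedSubgraph

open Finset

variable {V : Type*} [Fintype V]

/-- The corrections of a balanced subgraph that compensate for an exceptional component. -/
def IsCorrection (a b c d : ℤ) : Prop :=
  (a = 0 ∧ b = -1 ∧ c = 0 ∧ d = 1) ∨ (a = 1 ∧ b = 0 ∧ c = -1 ∧ d = 0) ∨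
  (a = 1 ∧ b = 1 ∧ c = -1 ∧ d = -1) ∨ (a = -1 ∧ b = -1 ∧ c = 1 ∧ d = 1) ∨
  (a = 1 ∧ b = -1 ∧ c = -1 ∧ d = 1)

/-- If no correction were available, each move whose shift is on the list would be blocked. When a
3–1 edge exists, leaves must match up with the vertices of degree 3, which leaves no place for a
neighbour of a vertex of degree 2; otherwise connectedness fails. -/
theorem exists_correction {G H : SimpleGraph V} (hG : ∀ v, dg G v = 3) (hc : Conn G)
    (hle : H ≤ G) (h1 : 0 < cnt H 1) (h2 : 0 < cnt H 2) (h13 : cnt H 3 ≤ cnt H 1) :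
    ∃ H' ≤ G, ∃ a b c d, Shift H H' a b c d ∧ IsCorrection a b c d := by
  classical
  by_contra! hn
  have hn : ∀ H' ≤ G, ∀ {a b c d : ℤ}, Shift H H' a b c d → IsCorrection a b c d → False :=
    fun H' hle {a b c d} h h' => hn H' hle a b c d h h'
  have hdg : ∀ v, dg H v ≤ 3 := fun v => by rw [← hG v]; exact dg_mono hle v
  have hadj : ∀ {v w}, H.Adj v w → dg H w = 1 ∨ dg H w = 2 ∨ dg H w = 3 := by
    intro v w h
    have := hdg w
    have := dg_pos h.symm
    omega
  have hthree : ∀ {v w}, dg H v = 3 → G.Adj v w → H.Adj v w := fun {v w} hv h =>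
    adj_of_dg_eq hle (by rw [hv, hG]) h
  have e12 : ∀ x y, H.Adj x y → dg H x = 1 → dg H y = 2 → False := fun x y h hx hy =>
    hn _ (del_le hle x y) (shift_del h hx hy) (by norm_num [chg, IsCorrection])
  have n12 : ∀ x y, G.Adj x y → ¬ H.Adj x y → dg H x = 1 → dg H y = 2 → False :=
    fun x y h h' hx hy =>
    hn _ (ins_le hle h) (shift_ins h.ne h' hx hy) (by norm_num [chg, IsCorrection])
  obtain ⟨w, hw⟩ := exists_of_cnt_pos h2
  by_cases hex : ∃ x r, H.Adj x r ∧ dg H x = 3 ∧ dg H r = 1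
  · obtain ⟨x₀, r₀, hxr, hx₀, hr₀⟩ := hex
    have e22 : ∀ x y, H.Adj x y → dg H x = 2 → dg H y = 2 → False := by
      intro x y h hx hy
      clear e12 n12 hadj hthree
      exact hn _ (del_le (del_le hle x y) x₀ r₀) ((shift_del h hx hy).trans
        (shift_del (i := 3) (j := 1) (by grind [adj_del]) (by grind [dg_del_eq])
          (by grind [dg_del_eq]))) (by norm_num [chg, IsCorrection])
    have n22 : ∀ x y, G.Adj x y → ¬ H.Adj x y → dg H x = 2 → dg H y = 2 → False := by
      intro x y h h' hx hy
      have hne := h.ne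
      clear e12 n12 hadj hthree e22
      exact hn _ (del_le (ins_le hle h) x₀ r₀) ((shift_ins hne h' hx hy).trans
        (shift_del (i := 3) (j := 1) (by grind [adj_ins]) (by grind [dg_ins_eq])
          (by grind [dg_ins_eq]))) (by norm_num [chg, IsCorrection])
    have hw3 : ∀ {x}, H.Adj w x → dg H x = 3 := by
      intro x hx
      rcases hadj hx with h | h | h
      · exact (e12 x w hx.symm h hw).elim
      · exact (e22 w x hx hw h).elim
      · exact h
    obtain ⟨u, hwu, hnu, hu⟩ : ∃ u, G.Adj w u ∧ ¬ H.Adj w u ∧ dg H u = 0 := by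
      have := dg_sdiff hle w
      rw [hG, hw] at this
      obtain ⟨u, hu⟩ := exists_adj_of_dg_pos (H := G \ H) (v := w) (by omega)
      refine ⟨u, hu.1, hu.2, ?_⟩
      have := hdg u
      obtain h | h | h | h : dg H u = 0 ∨ dg H u = 1 ∨ dg H u = 2 ∨ dg H u = 3 := by omega
      · exact h
      · exact (n12 u w hu.1.symm (fun h => hu.2 h.symm) h hw).elim
      · exact (n22 w u hu.1 hu.2 hw h).elim
      · exact (hu.2 (hthree h hu.1.symm).symm).elim
    have hwu' := hwu.ne
    have e11 : ∀ x y, H.Adj x y → dg H x = 1 → dg H y = 1 → False := by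
      intro x y h hx hy
      clear e12 n12 hadj hthree e22 n22 hw3
      exact hn _ (del_le (ins_le hle hwu) x y) ((shift_ins hwu' hnu hw hu).trans
        (shift_del (i := 1) (j := 1) (by grind [adj_ins]) (by grind [dg_ins_eq])
          (by grind [dg_ins_eq]))) (by norm_num [chg, IsCorrection])
    have e13 : ∀ {r x}, H.Adj r x → dg H r = 1 → dg H x = 3 := by
      intro r x h hr
      rcases hadj h with h' | h' | h'
      · exact (e11 r x h hr h').elim
      · exact (e12 r x h hr h').elim
      · exact h'
    have e132 : ∀ r x w, H.Adj x r → H.Adj x w → dg H r = 1 → dg H w = 2 → False := by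
      intro r x w hr hw' dr dw
      have dx := e13 hr.symm dr
      clear e12 n12 hadj hthree e22 n22 hw3 e11 e13
      exact hn _ (del_le (del_le hle x r) x w) ((shift_del hr dx dr).trans
        (shift_del (i := 2) (j := 2) (by grind [adj_del]) (by grind [dg_del_eq])
          (by grind [dg_del_eq]))) (by norm_num [chg, IsCorrection])
    have e131 : ∀ r x s, H.Adj x r → H.Adj x s → dg H r = 1 → dg H s = 1 → r ≠ s → False := by
      intro r x s hr hs dr ds hne
      have dx := e13 hr.symm dr
      clear e12 n12 hadj hthree e22 n22 hw3 e11 e13 e132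
      have d1 : (del H x r).Adj x s := by grind [adj_del]
      have e1 : dg (del H x r) x = 2 := by grind [dg_del_eq]
      have e2 : dg (del H x r) s = 1 := by grind [dg_del_eq]
      have d2 : ¬ (del (del H x r) x s).Adj w u := by grind [adj_del]
      have e3 : dg (del (del H x r) x s) w = 2 := by grind [dg_del_eq]
      have e4 : dg (del (del H x r) x s) u = 0 := by grind [dg_del_eq]
      exact hn _ (ins_le (del_le (del_le hle x r) x s) hwu) (((shift_del hr dx dr).trans
        (shift_del d1 e1 e2)).trans (shift_ins hwu' d2 e3 e4))
        (by norm_num [chg, IsCorrection])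
    have hf : ∀ r, ∃ x, dg H r = 1 → H.Adj r x := by
      intro r
      by_cases h : dg H r = 1
      · obtain ⟨x, hx⟩ := exists_adj_of_dg_pos (H := H) (v := r) (by omega)
        exact ⟨x, fun _ => hx⟩
      · exact ⟨r, fun h' => (h h').elim⟩
    choose f hf using hf
    -- Sending a leaf to its neighbour is injective into the vertices of degree 3, hence onto them
    -- by `h13`. So the neighbour of `w` carries a leaf, against `e132`.
    have himg : (univ.filter fun v => dg H v = 1).image f = univ.filter fun v => dg H v = 3 := by
      refine eq_of_subset_of_card_le ?_ ?_
      · intro x hx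
        obtain ⟨r, hr, rfl⟩ := mem_image.1 hx
        have dr : dg H r = 1 := by simpa using hr
        exact mem_filter.2 ⟨mem_univ _, e13 (hf r dr) dr⟩
      · rw [card_image_of_injOn]
        · exact h13
        · intro r hr s hs hrs
          have dr : dg H r = 1 := by simpa using hr
          have ds : dg H s = 1 := by simpa using hs
          by_contra hne
          have h' := (hf s ds).symm
          rw [← hrs] at h'
          exact e131 r (f r) s (hf r dr).symm h' dr ds hne
    obtain ⟨x, hx⟩ := exists_adj_of_dg_pos (H := H) (v := w) (by omega)
    have hx' : x ∈ (univ.filter fun v => dg H v = 1).image f := by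
      rw [himg]
      exact mem_filter.2 ⟨mem_univ _, hw3 hx⟩
    obtain ⟨r, hr, rfl⟩ := mem_image.1 hx'
    have dr : dg H r = 1 := by simpa using hr
    exact e132 r (f r) w (hf r dr).symm hx.symm dr hw
  · have e31 : ∀ x r, H.Adj x r → dg H x = 3 → dg H r = 1 → False :=
      fun x r h hx hr => hex ⟨x, r, h, hx, hr⟩
    obtain ⟨r, hr⟩ := exists_of_cnt_pos h1
    obtain ⟨s, hrs⟩ := exists_adj_of_dg_pos (H := H) (v := r) (by omega)
    have hs : dg H s = 1 := by
      rcases hadj hrs with h | h | h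
      · exact h
      · exact (e12 r s hrs hr h).elim
      · exact (e31 s r hrs.symm h hr).elim
    have n02 : ∀ x y, G.Adj x y → ¬ H.Adj x y → dg H x = 2 → dg H y = 0 → False := by
      intro x y h h' hx hy
      have hne := h.ne
      clear e12 n12 hadj hthree e31 hex
      exact hn _ (del_le (ins_le hle h) r s) ((shift_ins hne h' hx hy).trans
        (shift_del (i := 1) (j := 1) (by grind [adj_ins]) (by grind [dg_ins_eq])
          (by grind [dg_ins_eq]))) (by norm_num [chg, IsCorrection])
    -- With no 3–1 edges, no edge of `G` leaves the set of vertices of degree at least 2, although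
    -- `w` is in it and `r` is not.
    have := hc (fun v => 2 ≤ dg H v) (by
      intro x y hx hxy
      have dx := hdg x
      by_cases h : H.Adj x y
      · rcases hadj h with h' | h' | h'
        · exfalso
          obtain hx | hx : dg H x = 2 ∨ dg H x = 3 := by omega
          · exact e12 y x h.symm h' hx
          · exact e31 x y h hx h'
        · omega
        · omega
      · obtain hx | hx : dg H x = 2 ∨ dg H x = 3 := by omega
        · by_contra hy
          obtain hy | hy : dg H y = 0 ∨ dg H y = 1 := by omega
          · exact n02 x y hxy h hx hy
          · exact n12 y x hxy.symm (fun h' => h h'.symm) hy hx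
        · exact (h (hthree hx hxy)).elim) ⟨w, by omega⟩ r
    omega

end BalancedSubgraph

/-! ### Closed sets, components and achievable vectors. -/

namespace BalancedSubgraph

open Finset

variable {V W : Type*}

/-- `S` is closed under adjacency in `G`. -/
def Closed (G : SimpleGraph V) (S : Finset V) : Prop := ∀ x ∈ S, ∀ y, G.Adj x y → y ∈ S

/-- `f` embeds `G₀` in `G` as a spanning subgraph of the part of `G` on `S`. -/
def IsCopy (G₀ : SimpleGraph W) (G : SimpleGraph V) (S : Finset V) : Prop :=
  ∃ f : W → V, Function.Injective f ∧ (∀ v, v ∈ S ↔ ∃ w, f w = v) ∧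
    ∀ a b, G₀.Adj a b → G.Adj (f a) (f b)

theorem Closed.sdiff {G : SimpleGraph V} {S T : Finset V} [DecidableEq V] (hS : Closed G S)
    (hT : Closed G T) : Closed G (S \ T) := by
  intro x hx y hxy
  rw [mem_sdiff] at hx ⊢
  exact ⟨hS x hx.1 y hxy, fun hy => hx.2 (hT y hy x hxy.symm)⟩

theorem Closed.union {G : SimpleGraph V} {S T : Finset V} [DecidableEq V] (hS : Closed G S)
    (hT : Closed G T) : Closed G (S ∪ T) := by
  intro x hx y hxy
  rw [mem_union] at hx ⊢
  exact hx.imp (fun h => hS x h y hxy) fun h => hT x h y hxy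

/-- A nonempty set that is minimal among those closed under adjacency. -/
structure IsComp (G : SimpleGraph V) (S : Finset V) : Prop where
  nonempty : S.Nonempty
  closed : Closed G S
  eq_of_subset : ∀ T ⊆ S, T.Nonempty → Closed G T → T = S

theorem Closed.exists_isComp {G : SimpleGraph V} {S : Finset V} (hS : Closed G S)
    (hne : S.Nonempty) : ∃ C ⊆ S, IsComp G C := by
  classical
  obtain ⟨C, hC, hmin⟩ := (S.powerset.filter fun T => T.Nonempty ∧ Closed G T).exists_min_image
    Finset.card ⟨S, mem_filter.2 ⟨mem_powerset_self S, hne, hS⟩⟩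
  obtain ⟨hCS, hCne, hCc⟩ := mem_filter.1 hC
  rw [mem_powerset] at hCS
  refine ⟨C, hCS, hCne, hCc, fun T hT hTne hTc => ?_⟩
  exact eq_of_subset_of_card_le hT
    (hmin T (mem_filter.2 ⟨mem_powerset.2 (hT.trans hCS), hTne, hTc⟩))

theorem isCopy_induce (G : SimpleGraph V) (S : Finset V) :
    IsCopy (G.induce (S : Set V)) G S := by
  refine ⟨Subtype.val, Subtype.val_injective, fun v => ?_, fun a b h => h⟩
  simp

theorem IsCopy.comp {U : Type*} [Fintype W] {G₁ : SimpleGraph U} {G₀ : SimpleGraph W}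
    {G : SimpleGraph V} {S : Finset V} (h : IsCopy G₀ G S) (h' : IsCopy G₁ G₀ univ) :
    IsCopy G₁ G S := by
  obtain ⟨f, hf, hS, hadj⟩ := h
  obtain ⟨g, hg, hU, hadj'⟩ := h'
  refine ⟨f ∘ g, hf.comp hg, fun v => ?_, fun a b hab => hadj _ _ (hadj' a b hab)⟩
  rw [hS]
  constructor
  · rintro ⟨w, rfl⟩
    obtain ⟨u, rfl⟩ := (hU w).1 (mem_univ _)
    exact ⟨u, rfl⟩
  · rintro ⟨u, rfl⟩
    exact ⟨g u, rfl⟩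

theorem IsComp.conn_induce {G : SimpleGraph V} {S : Finset V} (h : IsComp G S) :
    Conn (G.induce (S : Set V)) := by
  classical
  rintro P hP ⟨x, hx⟩ y
  have hT := h.eq_of_subset (S.filter fun v => ∃ h : v ∈ (S : Set V), P ⟨v, h⟩)
    (filter_subset _ _) ⟨x, mem_filter.2 ⟨x.2, x.2, hx⟩⟩ (by
      intro u hu v huv
      obtain ⟨huS, hu', hPu⟩ := mem_filter.1 hu
      have hvS := h.closed u huS v huv
      exact mem_filter.2 ⟨hvS, hvS, hP ⟨u, hu'⟩ ⟨v, hvS⟩ hPu huv⟩)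
  have hy := hT.ge (y.2 : (y : V) ∈ S)
  obtain ⟨_, _, h'⟩ := mem_filter.1 hy
  exact h'

variable [Fintype V] [Fintype W]

/-- Some spanning subgraph of `G` has `a`, `b`, `c`, `d` vertices of degrees `0`, `1`, `2`, `3`
in `S`. -/
def Ach (G : SimpleGraph V) (S : Finset V) (a b c d : ℕ) : Prop :=
  ∃ H ≤ G, (S.filter fun v => dg H v = 0).card = a ∧ (S.filter fun v => dg H v = 1).card = b ∧
    (S.filter fun v => dg H v = 2).card = c ∧ (S.filter fun v => dg H v = 3).card = d

theorem dg_congr {H H' : SimpleGraph V} {v : V} (h : ∀ w, H.Adj v w ↔ H'.Adj v w) :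
    dg H v = dg H' v := by
  classical
  unfold dg
  congr 1
  ext w
  simp [h]

/-- No edge of `G` leaves `S` or `T`, so using one subgraph inside `S` and the other inside `T`
preserves all degrees there. -/
theorem Ach.union {G : SimpleGraph V} {S T : Finset V} [DecidableEq V] (hS : Closed G S)
    (hT : Closed G T) (hST : Disjoint S T) {a b c d a' b' c' d' : ℕ} (h : Ach G S a b c d)
    (h' : Ach G T a' b' c' d') : Ach G (S ∪ T) (a + a') (b + b') (c + c') (d + d') := by
  obtain ⟨H, hle, h0, h1, h2, h3⟩ := h
  obtain ⟨H', hle', h0', h1', h2', h3'⟩ := h'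
  rw [disjoint_left] at hST
  let K : SimpleGraph V :=
    { Adj := fun x y => x ∈ S ∧ y ∈ S ∧ H.Adj x y ∨ x ∈ T ∧ y ∈ T ∧ H'.Adj x y
      symm := ⟨fun _ _ h => h.imp (fun h => ⟨h.2.1, h.1, h.2.2.symm⟩)
        fun h => ⟨h.2.1, h.1, h.2.2.symm⟩⟩
      loopless := ⟨fun x h => h.elim (fun h => H.loopless.irrefl x h.2.2)
        fun h => H'.loopless.irrefl x h.2.2⟩ }
  have hK : ∀ v ∈ S, dg K v = dg H v := fun v hv => dg_congr fun w => by
    have := hST hv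
    constructor
    · rintro (h | h)
      · exact h.2.2
      · exact (this h.1).elim
    · exact fun h => Or.inl ⟨hv, hS v hv w (hle h), h⟩
  have hK' : ∀ v ∈ T, dg K v = dg H' v := fun v hv => dg_congr fun w => by
    have := fun h => hST (a := v) h hv
    constructor
    · rintro (h | h)
      · exact (this h.1).elim
      · exact h.2.2
    · exact fun h => Or.inr ⟨hv, hT v hv w (hle' h), h⟩
  have key : ∀ k, ((S ∪ T).filter fun v => dg K v = k).card =
      (S.filter fun v => dg H v = k).card + (T.filter fun v => dg H' v = k).card := by
    intro k
    rw [filter_union, card_union_of_disjoint]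
    · rw [filter_congr (fun v hv => by rw [hK v hv]), filter_congr (s := T)
        (fun v hv => by rw [hK' v hv])]
    · rw [disjoint_left]
      intro v hv hv'
      exact hST (mem_filter.1 hv).1 (mem_filter.1 hv').1
  refine ⟨K, ?_, ?_, ?_, ?_, ?_⟩
  · rintro x y (h | h)
    · exact hle h.2.2
    · exact hle' h.2.2
  all_goals rw [key]; omega

theorem Ach.compl {G : SimpleGraph V} (hG : ∀ v, dg G v = 3) {S : Finset V} {a b c d : ℕ}
    (h : Ach G S a b c d) : Ach G S d c b a := by
  obtain ⟨H, hle, h0, h1, h2, h3⟩ := h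
  have key : ∀ i j, i + j = 3 → (S.filter fun v => dg (G \ H) v = i).card =
      (S.filter fun v => dg H v = j).card := by
    intro i j hij
    congr 1
    refine filter_congr fun v _ => ?_
    have := dg_sdiff hle v
    rw [hG] at this
    omega
  refine ⟨G \ H, sdiff_le, ?_, ?_, ?_, ?_⟩
  · rw [key 0 3 rfl, h3]
  · rw [key 1 2 rfl, h2]
  · rw [key 2 1 rfl, h1]
  · rw [key 3 0 rfl, h0]

theorem dg_map {f : W → V} (hf : Function.Injective f) (H : SimpleGraph W) (w : W) :
    dg (H.map f) (f w) = dg H w := by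
  classical
  unfold dg
  rw [← card_image_of_injective _ hf]
  congr 1
  ext v
  simp only [mem_filter, mem_univ, true_and, mem_image]
  constructor
  · rintro ⟨-, a, b, hab, ha, rfl⟩
    exact ⟨b, hf ha ▸ hab, rfl⟩
  · rintro ⟨b, hb, rfl⟩
    exact ⟨fun h => hb.ne (hf h), w, b, hb, rfl, rfl⟩

theorem IsCopy.ach {G₀ : SimpleGraph W} {G : SimpleGraph V} {S : Finset V} (h : IsCopy G₀ G S)
    {H : SimpleGraph W} (hle : H ≤ G₀) :
    Ach G S (cnt H 0) (cnt H 1) (cnt H 2) (cnt H 3) := by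
  classical
  obtain ⟨f, hf, hS, hadj⟩ := h
  have key : ∀ k, (S.filter fun v => dg (H.map f) v = k).card = cnt H k := by
    intro k
    unfold cnt
    rw [← card_image_of_injective _ hf]
    congr 1
    ext v
    simp only [mem_filter, mem_univ, true_and, mem_image, hS]
    constructor
    · rintro ⟨⟨w, rfl⟩, hv⟩
      exact ⟨w, by rw [← hv, dg_map hf], rfl⟩
    · rintro ⟨w, hw, rfl⟩
      exact ⟨⟨w, rfl⟩, by rw [dg_map hf, hw]⟩
  refine ⟨H.map f, ?_, key 0, key 1, key 2, key 3⟩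
  intro x y hxy
  obtain ⟨-, a, b, hab, rfl, rfl⟩ := hxy
  exact hadj a b (hle hab)

theorem Ach.card {G : SimpleGraph V} (hG : ∀ v, dg G v = 3) {S : Finset V} {a b c d : ℕ}
    (h : Ach G S a b c d) : S.card = a + b + c + d := by
  classical
  obtain ⟨H, hle, h0, h1, h2, h3⟩ := h
  have h4 := card_eq_sum_card_fiberwise (f := dg H) (s := S) (t := range 4)
    (fun v _ => by
      have := dg_mono hle v
      rw [hG] at this
      simpa using Nat.lt_succ_of_le this)
  simp only [sum_range_succ, sum_range_zero, zero_add] at h4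
  rw [h4, ← h0, ← h1, ← h2, ← h3]

/-- The balanced count vectors, up to complementation. -/
def Good (G : SimpleGraph V) (S : Finset V) : Prop :=
  ∃ q, Ach G S q q q q ∨ Ach G S (q + 1) q (q + 1) q

theorem Good.union {G : SimpleGraph V} (hG : ∀ v, dg G v = 3) {S T : Finset V} [DecidableEq V]
    (hS : Closed G S) (hT : Closed G T) (hST : Disjoint S T) (h : Good G S) (h' : Good G T) :
    Good G (S ∪ T) := by
  obtain ⟨q, h | h⟩ := h <;> obtain ⟨r, h' | h'⟩ := h'
  · exact ⟨q + r, Or.inl (h.union hS hT hST h')⟩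
  · refine ⟨q + r, Or.inr ?_⟩
    simpa only [add_assoc] using h.union hS hT hST h'
  · refine ⟨q + r, Or.inr ?_⟩
    simpa only [add_right_comm] using h.union hS hT hST h'
  -- Two unequal vectors cancel once one of them is reversed.
  · refine ⟨q + r + 1, Or.inl ?_⟩
    convert h.union hS hT hST (h'.compl hG) using 1 <;> omega

theorem Closed.dg_induce {G : SimpleGraph V} {S : Finset V} (hS : Closed G S)
    (v : (S : Set V)) : dg (G.induce (S : Set V)) v = dg G v := by
  rw [← dg_map Subtype.val_injective]
  refine dg_congr fun w => ?_
  constructor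
  · rintro ⟨-, a, b, hab, ha, rfl⟩
    rw [← ha]
    exact hab
  · intro h
    exact ⟨h.ne, v, ⟨w, hS v v.2 w h⟩, h, rfl, rfl⟩

end BalancedSubgraph

/-! ### Explicit vectors for K₄ and K₃,₃. -/

namespace BalancedSubgraph

open Finset

theorem cnt_eq_card {W : Type*} [Fintype W] (H : SimpleGraph W) [DecidableRel H.Adj] (k : ℕ) :
    cnt H k = (univ.filter fun v => (univ.filter fun w => H.Adj v w).card = k).card := by
  unfold cnt dg
  congr!

/-- The bipartite graph with biadjacency matrix `M`. -/
def bip (M : Fin 3 → Fin 3 → Bool) : SimpleGraph (Fin 3 ⊕ Fin 3) where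
  Adj
    | Sum.inl i, Sum.inr j => M i j = true
    | Sum.inr j, Sum.inl i => M i j = true
    | _, _ => False
  symm := ⟨by rintro (i | i) (j | j) h <;> exact h⟩
  loopless := ⟨by rintro (i | i) h <;> exact h⟩

instance (M : Fin 3 → Fin 3 → Bool) : DecidableRel (bip M).Adj
  | Sum.inl i, Sum.inr j => inferInstanceAs (Decidable (M i j = true))
  | Sum.inr j, Sum.inl i => inferInstanceAs (Decidable (M i j = true))
  | Sum.inl _, Sum.inl _ => inferInstanceAs (Decidable False)
  | Sum.inr _, Sum.inr _ => inferInstanceAs (Decidable False)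

theorem bip_le (M : Fin 3 → Fin 3 → Bool) : bip M ≤ completeBipartiteGraph (Fin 3) (Fin 3) := by
  rintro (i | i) (j | j) h
  · exact h.elim
  · simp
  · simp
  · exact h.elim

/-- The graph on four vertices with the given pairs as edges. -/
def quad (l : List (Fin 4 × Fin 4)) : SimpleGraph (Fin 4) :=
  SimpleGraph.fromRel fun a b => (a, b) ∈ l

instance (l : List (Fin 4 × Fin 4)) : DecidableRel (quad l).Adj := fun a b =>
  inferInstanceAs (Decidable (a ≠ b ∧ ((a, b) ∈ l ∨ (b, a) ∈ l)))

variable {V : Type*} {G : SimpleGraph V} {S : Finset V}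

/-- `G` restricted to `S` is a complete graph on four vertices. -/
abbrev IsK4 (G : SimpleGraph V) (S : Finset V) : Prop :=
  IsCopy (SimpleGraph.completeGraph (Fin 4)) G S

/-- `G` restricted to `S` contains a complete bipartite graph with parts of size three. -/
abbrev IsK33 (G : SimpleGraph V) (S : Finset V) : Prop :=
  IsCopy (completeBipartiteGraph (Fin 3) (Fin 3)) G S

variable [Fintype V]

/-- The four counts form one decidable hypothesis, so `decide` settles each concrete vector. The
default in `getD` is never reached, since `k < 4`. -/
theorem IsCopy.ach_of_eq {W : Type*} [Fintype W] {G₀ : SimpleGraph W} (h : IsCopy G₀ G S)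
    (H : SimpleGraph W) [DecidableRel H.Adj] (hle : H ≤ G₀) (a b c d : ℕ)
    (hH : ∀ k, k < 4 → (univ.filter fun v => (univ.filter fun w => H.Adj v w).card = k).card =
      [a, b, c, d].getD k 0) : Ach G S a b c d := by
  have h' := h.ach hle
  simp only [cnt_eq_card] at h'
  rw [hH 0 (by norm_num), hH 1 (by norm_num), hH 2 (by norm_num), hH 3 (by norm_num)] at h'
  exact h'

theorem IsK4.ach2200 (h : IsK4 G S) : Ach G S 2 2 0 0 :=
  h.ach_of_eq (quad [(0, 1)]) le_top _ _ _ _ (by decide)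

theorem IsK4.ach0022 (h : IsK4 G S) : Ach G S 0 0 2 2 :=
  h.ach_of_eq (quad [(0, 2), (0, 3), (1, 2), (1, 3), (2, 3)]) le_top _ _ _ _ (by decide)

theorem IsK4.ach1210 (h : IsK4 G S) : Ach G S 1 2 1 0 :=
  h.ach_of_eq (quad [(0, 1), (1, 2)]) le_top _ _ _ _ (by decide)

theorem IsK4.ach0121 (h : IsK4 G S) : Ach G S 0 1 2 1 :=
  h.ach_of_eq (quad [(0, 1), (0, 2), (1, 2), (0, 3)]) le_top _ _ _ _ (by decide)

theorem IsK4.ach0220 (h : IsK4 G S) : Ach G S 0 2 2 0 :=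
  h.ach_of_eq (quad [(0, 1), (1, 2), (2, 3)]) le_top _ _ _ _ (by decide)

theorem IsK4.ach4000 (h : IsK4 G S) : Ach G S 4 0 0 0 :=
  h.ach_of_eq (quad []) le_top _ _ _ _ (by decide)

theorem IsK4.ach0301 (h : IsK4 G S) : Ach G S 0 3 0 1 :=
  h.ach_of_eq (quad [(0, 1), (0, 2), (0, 3)]) le_top _ _ _ _ (by decide)

theorem IsK33.ach2301 (h : IsK33 G S) : Ach G S 2 3 0 1 :=
  h.ach_of_eq (bip ![![false, false, false], ![false, false, false], ![true, true, true]])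
    (bip_le _) _ _ _ _ (by decide)

theorem IsK33.ach1032 (h : IsK33 G S) : Ach G S 1 0 3 2 :=
  h.ach_of_eq (bip ![![false, false, false], ![true, true, true], ![true, true, true]])
    (bip_le _) _ _ _ _ (by decide)

theorem IsK33.ach0024 (h : IsK33 G S) : Ach G S 0 0 2 4 :=
  h.ach_of_eq (bip ![![false, true, true], ![true, true, true], ![true, true, true]])
    (bip_le _) _ _ _ _ (by decide)

theorem IsK33.ach0222 (h : IsK33 G S) : Ach G S 0 2 2 2 :=
  h.ach_of_eq (bip ![![false, false, true], ![false, true, true], ![true, true, true]])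
    (bip_le _) _ _ _ _ (by decide)

theorem IsK33.ach4200 (h : IsK33 G S) : Ach G S 4 2 0 0 :=
  h.ach_of_eq (bip ![![false, false, false], ![false, false, false], ![false, false, true]])
    (bip_le _) _ _ _ _ (by decide)

theorem IsK33.ach2220 (h : IsK33 G S) : Ach G S 2 2 2 0 :=
  h.ach_of_eq (bip ![![false, false, false], ![false, false, true], ![false, true, true]])
    (bip_le _) _ _ _ _ (by decide)

theorem IsK33.ach1311 (h : IsK33 G S) : Ach G S 1 3 1 1 :=
  h.ach_of_eq (bip ![![false, false, false], ![false, false, true], ![true, true, true]])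
    (bip_le _) _ _ _ _ (by decide)

theorem IsK33.ach0123 (h : IsK33 G S) : Ach G S 0 1 2 3 :=
  h.ach_of_eq (bip ![![false, false, true], ![true, true, true], ![true, true, true]])
    (bip_le _) _ _ _ _ (by decide)

theorem IsK33.ach0321 (h : IsK33 G S) : Ach G S 0 3 2 1 :=
  h.ach_of_eq (bip ![![false, false, true], ![false, true, false], ![true, true, true]])
    (bip_le _) _ _ _ _ (by decide)

end BalancedSubgraph

/-! ### Small components, and absorbing an exceptional one. -/

namespace BalancedSubgraph

open Finset

section Small

variable {W : Type*} [Fintype W] {G : SimpleGraph W}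

theorem isK4_univ (hG : ∀ v, dg G v = 3) (hcard : Fintype.card W = 4) : IsK4 G univ := by
  classical
  let e := Fintype.equivFinOfCardEq hcard
  refine ⟨e.symm, e.symm.injective, fun v => by simpa using ⟨e v, e.symm_apply_apply v⟩, ?_⟩
  intro a b hab
  have hsub : (univ.filter fun w => G.Adj (e.symm a) w) ⊆ univ.erase (e.symm a) := by
    intro w hw
    have hw : G.Adj (e.symm a) w := by simpa using hw
    simpa using hw.ne.symm
  have heq := eq_of_subset_of_card_le hsub (by
    rw [card_erase_of_mem (mem_univ _), card_univ, hcard]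
    exact (hG _).ge)
  have hb : e.symm b ∈ univ.erase (e.symm a) := by simpa using hab.ne.symm
  rw [← heq] at hb
  simpa using hb

/-- The subgraph is the triangle with the third edge at `x`. On six vertices its vector is
(2,1,2,1). -/
theorem exists_of_triangle (hG : ∀ v, dg G v = 3) {x y z : W} (hxy : G.Adj x y)
    (hyz : G.Adj y z) (hxz : G.Adj x z) :
    ∃ H ≤ G, cnt H 0 + 4 = Fintype.card W ∧ cnt H 1 = 1 ∧ cnt H 2 = 2 ∧ cnt H 3 = 1 := by
  classical
  obtain ⟨w, hw, hwyz⟩ : ∃ w ∈ univ.filter fun w => G.Adj x w, w ∉ ({y, z} : Finset W) :=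
    exists_mem_notMem_of_card_lt_card (by
      rw [card_pair hyz.ne]
      exact Nat.lt_of_lt_of_le (by norm_num) (hG x).ge)
  have hxw : G.Adj x w := by simpa using hw
  have hwy : w ≠ y := fun h => hwyz (by simp [h])
  have hwz : w ≠ z := fun h => hwyz (by simp [h])
  have n1 := hxy.ne
  have n2 := hyz.ne
  have n3 := hxz.ne
  have n4 := hxw.ne
  have hbot : ∀ v, dg (⊥ : SimpleGraph W) v = 0 := by
    intro v
    simp [dg]
  have c0 : ∀ k, cnt (⊥ : SimpleGraph W) k = if k = 0 then Fintype.card W else 0 := by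
    intro k
    unfold cnt
    simp only [hbot]
    split_ifs with h
    · simp [h]
    · simp [Ne.symm h]
  have d1 : ¬ (⊥ : SimpleGraph W).Adj x y := by simp
  have d2 : ¬ (ins ⊥ x y).Adj y z := by simp only [adj_ins, SimpleGraph.bot_adj]; grind
  have d3 : ¬ (ins (ins ⊥ x y) y z).Adj x z := by
    simp only [adj_ins, SimpleGraph.bot_adj]; grind
  have d4 : ¬ (ins (ins (ins ⊥ x y) y z) x z).Adj x w := by
    simp only [adj_ins, SimpleGraph.bot_adj]; grind
  have b1 := dg_ins_eq n1 d1
  have b2 := dg_ins_eq n2 d2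
  have b3 := dg_ins_eq n3 d3
  have s := (((shift_ins n1 d1 (hbot x) (hbot y)).trans
    (shift_ins n2 d2 (i := 1) (j := 0) (by grind) (by grind))).trans
    (shift_ins n3 d3 (i := 1) (j := 1) (by grind) (by grind))).trans
    (shift_ins n4 d4 (i := 2) (j := 0) (by grind) (by grind))
  refine ⟨_, ins_le (ins_le (ins_le (ins_le bot_le hxy) hyz) hxz) hxw, ?_⟩
  norm_num [chg, Shift, c0] at s
  omega

/-- The three neighbours of a vertex are pairwise non-adjacent, so each is joined to all three
remaining vertices. -/
theorem isK33_univ (hG : ∀ v, dg G v = 3) (hcard : Fintype.card W = 6)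
    (htri : ∀ x y z, G.Adj x y → G.Adj y z → G.Adj x z → False) : IsK33 G univ := by
  classical
  obtain ⟨x⟩ : Nonempty W := Fintype.card_pos_iff.1 (by omega)
  set N : Finset W := univ.filter fun w => G.Adj x w with hN
  have hNc : N.card = 3 := hG x
  have hNc' : Nᶜ.card = 3 := by rw [card_compl, hcard, hNc]
  have hadj : ∀ a ∈ N, ∀ b ∈ Nᶜ, G.Adj a b := by
    intro a ha b hb
    have ha' : G.Adj x a := by simpa [hN] using ha
    have hsub : (univ.filter fun w => G.Adj a w) ⊆ Nᶜ := by
      intro w hw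
      have hw : G.Adj a w := by simpa using hw
      rw [mem_compl]
      intro hw'
      have hw' : G.Adj x w := by simpa [hN] using hw'
      exact htri x a w ha' hw hw'
    have heq := eq_of_subset_of_card_le hsub (by rw [hNc']; exact (hG a).ge)
    rw [← heq] at hb
    simpa using hb
  let e := N.equivFinOfCardEq hNc
  let e' := Nᶜ.equivFinOfCardEq hNc'
  refine ⟨Sum.elim (fun i => (e.symm i : W)) (fun j => (e'.symm j : W)), ?_, ?_, ?_⟩
  · refine Function.Injective.sumElim (Subtype.val_injective.comp e.symm.injective)
      (Subtype.val_injective.comp e'.symm.injective) ?_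
    intro i j h
    exact (mem_compl.1 (e'.symm j).2) (h ▸ (e.symm i).2)
  · intro v
    simp only [mem_univ, true_iff]
    by_cases hv : v ∈ N
    · exact ⟨Sum.inl (e ⟨v, hv⟩), by simp⟩
    · exact ⟨Sum.inr (e' ⟨v, mem_compl.2 hv⟩), by simp⟩
  · rintro (i | i) (j | j) h
    · simp at h
    · exact hadj _ (e.symm i).2 _ (e'.symm j).2
    · exact (hadj _ (e.symm j).2 _ (e'.symm i).2).symm
    · simp at h

theorem four_le_card (hG : ∀ v, dg G v = 3) [Nonempty W] : 4 ≤ Fintype.card W := by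
  classical
  obtain ⟨x⟩ := ‹Nonempty W›
  have h : (univ.filter fun w => G.Adj x w) ⊆ univ.erase x := by
    intro w hw
    have hw : G.Adj x w := by simpa using hw
    simpa using hw.ne.symm
  have := card_le_card h
  rw [card_erase_of_mem (mem_univ _), card_univ] at this
  have := hG x
  unfold dg at this
  omega

theorem even_card (hG : ∀ v, dg G v = 3) : Even (Fintype.card W) := by
  have h := sum_dg_even G
  simp only [hG, sum_const, card_univ, smul_eq_mul] at h
  exact (Nat.even_mul.1 h).resolve_right (by decide)

end Small

variable {V : Type*} [Fintype V] {G : SimpleGraph V} {S : Finset V}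

theorem IsComp.good_or (hG : ∀ v, dg G v = 3) (hS : IsComp G S) :
    Good G S ∨ IsK4 G S ∨ IsK33 G S := by
  classical
  have hG' : ∀ v, dg (G.induce (S : Set V)) v = 3 := fun v => by
    rw [hS.closed.dg_induce, hG]
  have hc := hS.conn_induce
  have hcopy := isCopy_induce G S
  have : Nonempty (S : Set V) := by
    obtain ⟨x, hx⟩ := hS.nonempty
    exact ⟨x, hx⟩
  have h4 := four_le_card hG'
  obtain ⟨m, hm⟩ := even_card hG'
  have hach : ∀ H ≤ G.induce (S : Set V), ∀ {a b c d : ℕ}, cnt H 0 = a → cnt H 1 = b →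
      cnt H 2 = c → cnt H 3 = d → Ach G S a b c d := by
    rintro H hle a b c d rfl rfl rfl rfl
    exact hcopy.ach hle
  -- Here `m` is half the order, so the first two cases are orders 4 and 6.
  obtain h | h | h | h : m = 2 ∨ m = 3 ∨ (∃ q, 2 ≤ q ∧ m = 2 * q) ∨
      (∃ q, 2 ≤ q ∧ m = 2 * q + 1) := by
    obtain ⟨r, hr | hr⟩ := m.even_or_odd'
    · by_cases h : m = 2
      · exact Or.inl h
      · exact Or.inr (Or.inr (Or.inl ⟨r, by omega, hr⟩))
    · by_cases h : m = 3
      · exact Or.inr (Or.inl h)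
      · exact Or.inr (Or.inr (Or.inr ⟨r, by omega, hr⟩))
  · exact Or.inr (Or.inl (hcopy.comp (isK4_univ hG' (by omega))))
  · by_cases htri : ∀ x y z, (G.induce (S : Set V)).Adj x y → (G.induce (S : Set V)).Adj y z →
        (G.induce (S : Set V)).Adj x z → False
    · exact Or.inr (Or.inr (hcopy.comp (isK33_univ hG' (by omega) htri)))
    · push Not at htri
      obtain ⟨x, y, z, hxy, hyz, hxz, -⟩ := htri
      obtain ⟨H, hle, h0, h1, h2, h3⟩ := exists_of_triangle hG' hxy hyz hxz
      exact Or.inl ⟨1, Or.inr (hach H hle (by omega) h1 h2 h3)⟩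
  · obtain ⟨q, hq, rfl⟩ := h
    obtain ⟨H, hle, h0, h1, h2, h3⟩ := exists_balanced_of_conn hG' hc hq (by omega)
    exact Or.inl ⟨q, Or.inl (hach H hle h0 h1 h2 h3)⟩
  · obtain ⟨q, hq, rfl⟩ := h
    obtain ⟨H, hle, ⟨h0, h1, h2, h3⟩ | ⟨h0, h1, h2, h3⟩⟩ :=
      exists_balanced_of_conn' hG' hc hq (by omega)
    · exact Or.inl ⟨q, Or.inr ((hach H hle h0 h1 h2 h3).compl hG)⟩
    · exact Or.inl ⟨q, Or.inr (hach H hle h0 h1 h2 h3)⟩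

theorem Ach.exists_induce (hS : Closed G S) {a b c d : ℕ} (h : Ach G S a b c d) :
    ∃ H ≤ G.induce (S : Set V), cnt H 0 = a ∧ cnt H 1 = b ∧ cnt H 2 = c ∧ cnt H 3 = d := by
  classical
  obtain ⟨H, hle, h0, h1, h2, h3⟩ := h
  have hS' : Closed H S := fun x hx y hxy => hS x hx y (hle hxy)
  have key : ∀ k, cnt (H.induce (S : Set V)) k = (S.filter fun v => dg H v = k).card := by
    intro k
    unfold cnt
    rw [← card_image_of_injective _ Subtype.val_injective]
    congr 1
    ext v
    simp only [mem_image, mem_filter, mem_univ, true_and, hS'.dg_induce]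
    constructor
    · rintro ⟨w, hw, rfl⟩
      exact ⟨w.2, hw⟩
    · rintro ⟨hv, hk⟩
      exact ⟨⟨v, hv⟩, hk, rfl⟩
  exact ⟨H.induce (S : Set V), fun x y h => hle h, by rw [key, h0], by rw [key, h1],
    by rw [key, h2], by rw [key, h3]⟩

theorem Good.exists_correction (hG : ∀ v, dg G v = 3) (hS : IsComp G S) (h : Good G S) :
    ∃ p q a b c d : ℕ, (p = q ∨ p = q + 1) ∧ Ach G S a b c d ∧
      IsCorrection ((a : ℤ) - p) (b - q) (c - p) (d - q) := by
  classical
  have hG' : ∀ v, dg (G.induce (S : Set V)) v = 3 := fun v => by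
    rw [hS.closed.dg_induce, hG]
  have : Nonempty (S : Set V) := by
    obtain ⟨x, hx⟩ := hS.nonempty
    exact ⟨x, hx⟩
  have h4 := four_le_card hG'
  obtain ⟨p, q, hpq, hach⟩ : ∃ p q : ℕ, (p = q ∨ p = q + 1) ∧ Ach G S p q p q := by
    obtain ⟨q, h | h⟩ := h
    · exact ⟨q, q, Or.inl rfl, h⟩
    · exact ⟨q + 1, q, Or.inr rfl, h⟩
  obtain ⟨H, hle, h0, h1, h2, h3⟩ := hach.exists_induce hS.closed
  have hsum := cnt_sum (H := H) fun v => by rw [← hG' v]; exact dg_mono hle v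
  obtain ⟨H', hle', a, b, c, d, hs, hcor⟩ := BalancedSubgraph.exists_correction hG'
    hS.conn_induce hle (by omega) (by omega) (by omega)
  refine ⟨p, q, _, _, _, _, hpq, (isCopy_induce G S).ach hle', ?_⟩
  obtain ⟨s0, s1, s2, s3⟩ := hs
  rw [s0, s1, s2, s3, h0, h1, h2, h3]
  simpa using hcor

/-- The K₄ makes the correction up to (1,1,1,1), keeping the total balanced. -/
theorem IsK4.exists_ach (h : IsK4 G S) {a b c d : ℤ} (hcor : IsCorrection a b c d) :
    ∃ a' b' c' d' : ℕ, Ach G S a' b' c' d' ∧ a + a' = 1 ∧ b + b' = 1 ∧ c + c' = 1 ∧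
      d + d' = 1 := by
  rcases hcor with ⟨rfl, rfl, rfl, rfl⟩ | ⟨rfl, rfl, rfl, rfl⟩ | ⟨rfl, rfl, rfl, rfl⟩ |
    ⟨rfl, rfl, rfl, rfl⟩ | ⟨rfl, rfl, rfl, rfl⟩
  · exact ⟨_, _, _, _, h.ach1210, by norm_num⟩
  · exact ⟨_, _, _, _, h.ach0121, by norm_num⟩
  · exact ⟨_, _, _, _, h.ach0022, by norm_num⟩
  · exact ⟨_, _, _, _, h.ach2200, by norm_num⟩
  · exact ⟨_, _, _, _, h.ach0220, by norm_num⟩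

/-- With six vertices the correction is made up to (1,2,1,2), which exchanges the two kinds of
balanced vector up to reversal. -/
theorem IsK33.exists_ach (h : IsK33 G S) {a b c d : ℤ} (hcor : IsCorrection a b c d) :
    ∃ a' b' c' d' : ℕ, Ach G S a' b' c' d' ∧ a + a' = 1 ∧ b + b' = 2 ∧ c + c' = 1 ∧
      d + d' = 2 := by
  rcases hcor with ⟨rfl, rfl, rfl, rfl⟩ | ⟨rfl, rfl, rfl, rfl⟩ | ⟨rfl, rfl, rfl, rfl⟩ |
    ⟨rfl, rfl, rfl, rfl⟩ | ⟨rfl, rfl, rfl, rfl⟩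
  · exact ⟨_, _, _, _, h.ach1311, by norm_num⟩
  · exact ⟨_, _, _, _, h.ach0222, by norm_num⟩
  · exact ⟨_, _, _, _, h.ach0123, by norm_num⟩
  · exact ⟨_, _, _, _, h.ach2301, by norm_num⟩
  · exact ⟨_, _, _, _, h.ach0321, by norm_num⟩

theorem Good.union_isK4 [DecidableEq V] (hG : ∀ v, dg G v = 3) {T : Finset V} (hS : IsComp G S)
    (hT : Closed G T) (hST : Disjoint S T) (h : Good G S) (h' : IsK4 G T) : Good G (S ∪ T) := by
  obtain ⟨p, q, a, b, c, d, hpq, hach, hcor⟩ := h.exists_correction hG hS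
  obtain ⟨a', b', c', d', hach', e0, e1, e2, e3⟩ := h'.exists_ach hcor
  have hu := hach.union hS.closed hT hST hach'
  obtain rfl | rfl := hpq
  · refine ⟨p + 1, Or.inl ?_⟩
    convert hu using 1 <;> omega
  · refine ⟨q + 1, Or.inr ?_⟩
    convert hu using 1 <;> omega

theorem Good.union_isK33 [DecidableEq V] (hG : ∀ v, dg G v = 3) {T : Finset V}
    (hS : IsComp G S) (hT : Closed G T) (hST : Disjoint S T) (h : Good G S) (h' : IsK33 G T) :
    Good G (S ∪ T) := by
  obtain ⟨p, q, a, b, c, d, hpq, hach, hcor⟩ := h.exists_correction hG hS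
  obtain ⟨a', b', c', d', hach', e0, e1, e2, e3⟩ := h'.exists_ach hcor
  have hu := hach.union hS.closed hT hST hach'
  obtain rfl | rfl := hpq
  · refine ⟨p + 1, Or.inr (Ach.compl hG ?_)⟩
    convert hu using 1 <;> omega
  · refine ⟨q + 2, Or.inl ?_⟩
    convert hu using 1 <;> omega

end BalancedSubgraph

/-! ### Gluing components by induction. -/

namespace BalancedSubgraph

open Finset

variable {V : Type*}

theorem IsCopy.nonempty {W : Type*} [Nonempty W] {G₀ : SimpleGraph W} {G : SimpleGraph V}
    {S : Finset V} (h : IsCopy G₀ G S) :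
    S.Nonempty := by
  obtain ⟨f, -, hS, -⟩ := h
  inhabit W
  exact ⟨f default, (hS _).2 ⟨default, rfl⟩⟩

variable {G : SimpleGraph V} {S T A B : Finset V}

variable [DecidableEq V]

/-- `S` splits into three copies of the complete graph on four vertices. -/
def IsK444 (G : SimpleGraph V) (S : Finset V) : Prop :=
  ∃ A B C, Closed G A ∧ Closed G B ∧ Closed G C ∧ Disjoint A B ∧ Disjoint (A ∪ B) C ∧
    IsK4 G A ∧ IsK4 G B ∧ IsK4 G C ∧ A ∪ B ∪ C = S

theorem IsK444.exists_isK4_isK4 (h : IsK444 G T) (hTS : T ⊆ S) :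
    ∃ A B, A ∪ B ⊆ S ∧ Closed G A ∧ Closed G B ∧ Disjoint A B ∧ IsK4 G A ∧ IsK4 G B := by
  obtain ⟨A, B, C, hA, hB, -, hAB, -, kA, kB, -, rfl⟩ := h
  exact ⟨A, B, subset_union_left.trans hTS, hA, hB, hAB, kA, kB⟩

variable [Fintype V]

/-- `S` is balanced or one of the exceptional graphs. -/
def Reduced (G : SimpleGraph V) (S : Finset V) : Prop :=
  Good G S ∨ IsK4 G S ∨ IsK33 G S ∨ IsK444 G S

/-- Two K₄ together achieve (2,2,2,2). An exceptional remainder needs vectors chosen jointly: a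
third K₄ gives the exception 3K₄, while five K₄ achieve (5,5,5,5). -/
theorem reduced_union_of_isK4_isK4 (hG : ∀ v, dg G v = 3) (hA : Closed G A) (hB : Closed G B)
    (hAB : Disjoint A B) (hT : Closed G T) (hABT : Disjoint (A ∪ B) T) (kA : IsK4 G A)
    (kB : IsK4 G B) (h : T = ∅ ∨ Reduced G T) : Reduced G (A ∪ B ∪ T) := by
  have hgood : Good G (A ∪ B) := ⟨2, Or.inl (kA.ach2200.union hA hB hAB kB.ach0022)⟩
  obtain rfl | h | h | h | h := h
  · exact Or.inl (by rwa [union_empty])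
  · exact Or.inl (hgood.union hG (hA.union hB) hT hABT h)
  · exact Or.inr (Or.inr (Or.inr ⟨A, B, T, hA, hB, hT, hAB, hABT, kA, kB, h, rfl⟩))
  · exact Or.inl ⟨3, Or.inr (((kA.ach2200.union hA hB hAB kB.ach1210).union (hA.union hB) hT hABT
      h.ach0024).compl hG)⟩
  · obtain ⟨A', B', C', hA', hB', hC', hAB', hABC', kA', kB', kC', rfl⟩ := h
    exact Or.inl ⟨5, Or.inl ((kA.ach4000.union hA hB hAB kB.ach0301).union (hA.union hB) hT hABT
      ((kA'.ach0022.union hA' hB' hAB' kB'.ach0022).union (hA'.union hB') hC' hABC'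
        kC'.ach1210))⟩

theorem reduced_union_of_isK33_isK33 (hG : ∀ v, dg G v = 3) (hA : Closed G A) (hB : Closed G B)
    (hAB : Disjoint A B) (hT : Closed G T) (hABT : Disjoint (A ∪ B) T) (kA : IsK33 G A)
    (kB : IsK33 G B) (h : T = ∅ ∨ Reduced G T) (hT' : ¬ IsK444 G T) :
    Reduced G (A ∪ B ∪ T) := by
  have hgood : Good G (A ∪ B) := ⟨3, Or.inl (kA.ach2301.union hA hB hAB kB.ach1032)⟩
  obtain rfl | h | h | h | h := h
  · exact Or.inl (by rwa [union_empty])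
  · exact Or.inl (hgood.union hG (hA.union hB) hT hABT h)
  · exact Or.inl ⟨4, Or.inl ((kA.ach0222.union hA hB hAB kB.ach4200).union (hA.union hB) hT hABT
      h.ach0022)⟩
  · exact Or.inl ⟨4, Or.inr (((kA.ach2301.union hA hB hAB kB.ach0024).union (hA.union hB) hT hABT
      h.ach2220).compl hG)⟩
  · exact (hT' h).elim

theorem reduced_union_of_good (hG : ∀ v, dg G v = 3) (hA : IsComp G A) (hT : Closed G T)
    (hAT : Disjoint A T) (gA : Good G A) (h : T = ∅ ∨ Reduced G T) (hT' : ¬ IsK444 G T) :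
    Reduced G (A ∪ T) := by
  obtain rfl | h | h | h | h := h
  · exact Or.inl (by rwa [union_empty])
  · exact Or.inl (gA.union hG hA.closed hT hAT h)
  · exact Or.inl (gA.union_isK4 hG hA hT hAT h)
  · exact Or.inl (gA.union_isK33 hG hA hT hAT h)
  · exact (hT' h).elim

theorem Closed.reduced (hG : ∀ v, dg G v = 3) (hS : Closed G S) (hne : S.Nonempty) :
    Reduced G S := by
  induction hn : S.card using Nat.strong_induction_on generalizing S with
  | _ n ih =>
  subst hn
  have ih' : ∀ U ⊆ S, Closed G U → U.Nonempty → S \ U = ∅ ∨ Reduced G (S \ U) := by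
    intro U hU hUc hUne
    obtain h | h := (S \ U).eq_empty_or_nonempty
    · exact Or.inl h
    · exact Or.inr (ih _ (card_lt_card (sdiff_ssubset hU hUne)) (hS.sdiff hUc) h rfl)
  by_cases h44 : ∃ A B, A ∪ B ⊆ S ∧ Closed G A ∧ Closed G B ∧ Disjoint A B ∧ IsK4 G A ∧ IsK4 G B
  · obtain ⟨A, B, hsub, hA, hB, hAB, kA, kB⟩ := h44
    rw [← union_sdiff_of_subset hsub]
    exact reduced_union_of_isK4_isK4 hG hA hB hAB (hS.sdiff (hA.union hB)) disjoint_sdiff kA kB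
      (ih' _ hsub (hA.union hB) (kA.nonempty.mono subset_union_left))
  -- A remainder 3K₄ would supply two K₄, the case just settled.
  have hK444 : ∀ U, ¬ IsK444 G (S \ U) := fun U h => h44 (h.exists_isK4_isK4 sdiff_subset)
  by_cases h33 : ∃ A B, A ∪ B ⊆ S ∧ Closed G A ∧ Closed G B ∧ Disjoint A B ∧ IsK33 G A ∧
      IsK33 G B
  · obtain ⟨A, B, hsub, hA, hB, hAB, kA, kB⟩ := h33
    rw [← union_sdiff_of_subset hsub]
    exact reduced_union_of_isK33_isK33 hG hA hB hAB (hS.sdiff (hA.union hB)) disjoint_sdiff kA kB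
      (ih' _ hsub (hA.union hB) (kA.nonempty.mono subset_union_left)) (hK444 _)
  by_cases hgood : ∃ C ⊆ S, IsComp G C ∧ Good G C
  · obtain ⟨C, hsub, hC, gC⟩ := hgood
    rw [← union_sdiff_of_subset hsub]
    exact reduced_union_of_good hG hC (hS.sdiff hC.closed) disjoint_sdiff gC
      (ih' _ hsub hC.closed hC.nonempty) (hK444 _)
  have hcomp : ∀ C ⊆ S, IsComp G C → IsK4 G C ∨ IsK33 G C := fun C hsub hC =>
    (hC.good_or hG).resolve_left fun h => hgood ⟨C, hsub, hC, h⟩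
  obtain ⟨C, hCS, hC⟩ := hS.exists_isComp hne
  obtain hR | hR := (S \ C).eq_empty_or_nonempty
  · obtain rfl : S = C := (sdiff_eq_empty_iff_subset.1 hR).antisymm hCS
    exact Or.inr ((hcomp S hCS hC).imp_right Or.inl)
  obtain ⟨D, hDR, hD⟩ := (hS.sdiff hC.closed).exists_isComp hR
  obtain ⟨hDS, hDC⟩ := subset_sdiff.1 hDR
  have hno4 : ∀ A ⊆ S, ∀ B ⊆ S, IsComp G A → IsComp G B → Disjoint A B → IsK4 G A → IsK33 G B :=
    fun A hAS B hBS hA hB hAB kA => (hcomp B hBS hB).resolve_left fun kB =>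
      h44 ⟨A, B, union_subset hAS hBS, hA.closed, hB.closed, hAB, kA, kB⟩
  have hno33 : ∀ A ⊆ S, ∀ B ⊆ S, IsComp G A → IsComp G B → Disjoint A B → IsK33 G A → IsK4 G B :=
    fun A hAS B hBS hA hB hAB kA => (hcomp B hBS hB).resolve_right fun kB =>
      h33 ⟨A, B, union_subset hAS hBS, hA.closed, hB.closed, hAB, kA, kB⟩
  -- Among three components, two would be of the same exceptional type.
  have hmix : S \ (C ∪ D) = ∅ := by
    by_contra hE
    obtain ⟨E, hER, hE⟩ := (hS.sdiff (hC.closed.union hD.closed)).exists_isComp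
      (nonempty_iff_ne_empty.2 hE)
    obtain ⟨hES, hECD⟩ := subset_sdiff.1 hER
    obtain ⟨hEC, hED⟩ := disjoint_union_right.1 hECD
    obtain k | k := hcomp C hCS hC
    · have kD := hno4 C hCS D hDS hC hD hDC.symm k
      have kE := hno4 C hCS E hES hC hE hEC.symm k
      exact h33 ⟨E, D, union_subset hES hDS, hE.closed, hD.closed, hED, kE, kD⟩
    · have kD := hno33 C hCS D hDS hC hD hDC.symm k
      have kE := hno33 C hCS E hES hC hE hEC.symm k
      exact h44 ⟨E, D, union_subset hES hDS, hE.closed, hD.closed, hED, kE, kD⟩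
  have hSCD : S = C ∪ D :=
    (sdiff_eq_empty_iff_subset.1 hmix).antisymm (union_subset hCS hDS)
  rw [hSCD]
  obtain k | k := hcomp C hCS hC
  · exact Or.inl ⟨2, Or.inr ((k.ach0022.union hC.closed hD.closed hDC.symm
      (hno4 C hCS D hDS hC hD hDC.symm k).ach2301).compl hG)⟩
  · exact Or.inl ⟨2, Or.inr ((k.ach2301.union hC.closed hD.closed hDC.symm
      (hno33 C hCS D hDS hC hD hDC.symm k).ach0022).compl hG)⟩

end BalancedSubgraph

/-! ### Isomorphisms, disjoint sums and obstructions. -/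

namespace BalancedSubgraph

open Finset

section Iso

variable {V W : Type*} [Fintype V] [Fintype W]

/-- Equal degrees leave no room in `G` for edges outside the copy. -/
theorem IsCopy.nonempty_iso {G₀ : SimpleGraph W} {G : SimpleGraph V} (h : IsCopy G₀ G univ)
    (hdg : ∀ a b, dg G₀ a = dg G b) : Nonempty (G ≃g G₀) := by
  obtain ⟨f, hf, hS, hadj⟩ := h
  have hbij : Function.Bijective f := ⟨hf, fun v => (hS v).1 (mem_univ v)⟩
  have hle : G₀.map f ≤ G := by
    rintro x y ⟨-, a, b, hab, rfl, rfl⟩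
    exact hadj a b hab
  refine ⟨RelIso.symm ⟨Equiv.ofBijective f hbij, fun {a b} => ⟨fun hab => ?_, hadj a b⟩⟩⟩
  obtain ⟨-, c, d, hcd, hc, hd⟩ := adj_of_dg_eq hle ((dg_map hf G₀ a).trans (hdg a (f a))) hab
  rwa [← hf hc, ← hf hd]

theorem isCopy_of_iso {U : Type*} {G₀ : SimpleGraph U} {G : SimpleGraph V} (e : G ≃g G₀) :
    IsCopy G₀ G univ :=
  ⟨e.symm, e.symm.injective, fun v => by simpa using ⟨e v, e.symm_apply_apply v⟩,
    fun _ _ h => e.symm.map_rel_iff.2 h⟩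

theorem cnt_map {f : V → W} (hf : Function.Bijective f) (H : SimpleGraph V) (k : ℕ) :
    cnt (H.map f) k = cnt H k := by
  classical
  unfold cnt
  rw [← card_image_of_injective _ hf.injective]
  congr 1
  ext v
  obtain ⟨w, rfl⟩ := hf.surjective v
  simp [dg_map hf.injective, hf.injective.eq_iff]

theorem HasDegreeBalancedSubgraph.of_iso {G : SimpleGraph V} {G₀ : SimpleGraph W} (e : G ≃g G₀)
    {r : ℝ} (h : HasDegreeBalancedSubgraph G r) : HasDegreeBalancedSubgraph G₀ r := by
  obtain ⟨H, hle, hH⟩ := h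
  refine ⟨H.map e, ?_, fun k hk => ?_⟩
  · rintro x y ⟨-, a, b, hab, rfl, rfl⟩
    exact e.map_rel_iff.2 (hle hab)
  · have := hH k hk
    rw [degreeCount_eq_cnt] at this ⊢
    rwa [cnt_map e.bijective, ← Fintype.card_congr e.toEquiv]

theorem Ach.hasDegreeBalancedSubgraph {G : SimpleGraph V} (hG : ∀ v, dg G v = 3)
    {a b c d : ℕ} (h : Ach G univ a b c d) {r : ℝ}
    (ha : |(a : ℝ) - (a + b + c + d : ℕ) / 4| ≤ r) (hb : |(b : ℝ) - (a + b + c + d : ℕ) / 4| ≤ r)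
    (hc : |(c : ℝ) - (a + b + c + d : ℕ) / 4| ≤ r)
    (hd : |(d : ℝ) - (a + b + c + d : ℕ) / 4| ≤ r) : HasDegreeBalancedSubgraph G r := by
  have hcard := h.card hG
  obtain ⟨H, hle, h0, h1, h2, h3⟩ := h
  refine ⟨H, hle, fun k hk => ?_⟩
  rw [degreeCount_eq_cnt, ← card_univ, hcard]
  unfold cnt
  interval_cases k
  · rwa [h0]
  · rwa [h1]
  · rwa [h2]
  · rwa [h3]

theorem Good.hasDegreeBalancedSubgraph {G : SimpleGraph V} (hG : ∀ v, dg G v = 3)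
    (h : Good G univ) : HasDegreeBalancedSubgraph G (1 / 2) := by
  obtain ⟨q, h | h⟩ := h <;> apply h.hasDegreeBalancedSubgraph hG <;> push_cast <;>
    ring_nf <;> norm_num

end Iso

section Sum

variable {α β : Type*}

theorem IsCopy.sum {V : Type*} [DecidableEq V] {G : SimpleGraph V} {S T : Finset V}
    {G₁ : SimpleGraph α} {G₂ : SimpleGraph β} (h₁ : IsCopy G₁ G S) (h₂ : IsCopy G₂ G T)
    (hST : Disjoint S T) : IsCopy (SimpleGraph.sum G₁ G₂) G (S ∪ T) := by
  obtain ⟨f, hf, hS, hadj⟩ := h₁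
  obtain ⟨g, hg, hT, hadj'⟩ := h₂
  refine ⟨Sum.elim f g, hf.sumElim hg fun a b hab => ?_, fun v => ?_, ?_⟩
  · exact disjoint_left.1 hST ((hS _).2 ⟨a, rfl⟩) ((hT _).2 ⟨b, hab.symm⟩)
  · simp [hS, hT]
  · rintro (a | a) (b | b) h
    · exact hadj a b h
    · simp at h
    · simp at h
    · exact hadj' a b h

theorem sum_graph_mono {G₁ H₁ : SimpleGraph α} {G₂ H₂ : SimpleGraph β} (h₁ : H₁ ≤ G₁)
    (h₂ : H₂ ≤ G₂) : SimpleGraph.sum H₁ H₂ ≤ SimpleGraph.sum G₁ G₂ := by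
  rintro (a | a) (b | b) h
  · exact h₁ h
  · simp at h
  · simp at h
  · exact h₂ h

variable [Fintype α] [Fintype β]

theorem dg_eq_dg_of_adj_iff {f : α → β} (hf : Function.Injective f) {H : SimpleGraph α}
    {H' : SimpleGraph β} {a : α} (h : ∀ v, H'.Adj (f a) v ↔ ∃ b, H.Adj a b ∧ f b = v) :
    dg H' (f a) = dg H a := by
  classical
  unfold dg
  rw [← card_image_of_injective _ hf]
  congr 1
  ext v
  simp [h]

theorem dg_inl {H : SimpleGraph (α ⊕ β)} (h : ∀ a b, ¬ H.Adj (Sum.inl a) (Sum.inr b)) (a : α) :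
    dg H (Sum.inl a) = dg (H.comap Sum.inl) a := by
  refine dg_eq_dg_of_adj_iff Sum.inl_injective ?_
  rintro (b | b) <;> simp [h]

theorem dg_inr {H : SimpleGraph (α ⊕ β)} (h : ∀ a b, ¬ H.Adj (Sum.inl a) (Sum.inr b)) (b : β) :
    dg H (Sum.inr b) = dg (H.comap Sum.inr) b := by
  refine dg_eq_dg_of_adj_iff Sum.inr_injective ?_
  rintro (a | a) <;> simp [h, SimpleGraph.adj_comm]

theorem cnt_eq_add {H : SimpleGraph (α ⊕ β)}
    (h : ∀ a b, ¬ H.Adj (Sum.inl a) (Sum.inr b)) (k : ℕ) :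
    cnt H k = cnt (H.comap Sum.inl) k + cnt (H.comap Sum.inr) k := by
  simp only [cnt, card_filter, Fintype.sum_sum_type, dg_inl h, dg_inr h]

theorem dg_sum_graph {G₁ : SimpleGraph α} {G₂ : SimpleGraph β} {k : ℕ} (h₁ : ∀ v, dg G₁ v = k)
    (h₂ : ∀ v, dg G₂ v = k) (v : α ⊕ β) : dg (SimpleGraph.sum G₁ G₂) v = k := by
  obtain v | v := v
  · rw [dg_inl (by simp), ← h₁ v]
    rfl
  · rw [dg_inr (by simp), ← h₂ v]
    rfl

theorem cnt_sum_graph (G₁ : SimpleGraph α) (G₂ : SimpleGraph β) (k : ℕ) :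
    cnt (SimpleGraph.sum G₁ G₂) k = cnt G₁ k + cnt G₂ k := by
  rw [cnt_eq_add (by simp)]
  rfl

end Sum

section Complete

variable {W : Type*} [Fintype W] {H : SimpleGraph W}

/-- A sole non-isolated vertex would have a neighbour, itself non-isolated. -/
theorem cnt_zero_add_one_ne (H : SimpleGraph W) : cnt H 0 + 1 ≠ Fintype.card W := by
  classical
  intro h
  have hc : (univ.filter fun v => ¬ dg H v = 0).card = 1 := by
    have := card_filter_add_card_filter_not (s := (univ : Finset W)) fun v => dg H v = 0
    rw [card_univ] at this
    unfold cnt at h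
    omega
  obtain ⟨v, hv⟩ := card_eq_one.1 hc
  have hv' : v ∈ univ.filter fun v => ¬ dg H v = 0 := by simp [hv]
  obtain ⟨w, hw⟩ := exists_adj_of_dg_pos (Nat.pos_of_ne_zero (mem_filter.1 hv').2)
  have hw' : w ∈ univ.filter fun v => ¬ dg H v = 0 :=
    mem_filter.2 ⟨mem_univ w, (dg_pos hw.symm).ne'⟩
  rw [hv, mem_singleton] at hw'
  exact hw.ne hw'.symm

theorem cnt_three_add_one_ne {G : SimpleGraph W} (hG : ∀ v, dg G v = 3) (hle : H ≤ G) :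
    cnt H 3 + 1 ≠ Fintype.card W := by
  have h : cnt H 3 = cnt (G \ H) 0 := by
    unfold cnt
    congr 1
    refine filter_congr fun v _ => ?_
    have := dg_sdiff hle v
    rw [hG] at this
    omega
  rw [h]
  exact cnt_zero_add_one_ne _

theorem cnt_zero_eq_or_cnt_three_eq (h3 : ∀ v, dg (⊤ : SimpleGraph W) v = 3) :
    cnt H 0 = 0 ∨ cnt H 3 = 0 := by
  unfold cnt
  simp only [card_eq_zero, filter_eq_empty_iff, mem_univ, true_imp_iff]
  by_contra! h
  obtain ⟨⟨u, hu⟩, v, hv⟩ := h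
  have huv : v ≠ u := by
    rintro rfl
    omega
  have := dg_pos (adj_of_dg_eq (H := H) le_top (hv.trans (h3 v).symm)
    ((SimpleGraph.top_adj v u).2 huv)).symm
  omega

end Complete

end BalancedSubgraph

/-! ### The exceptional graphs and the conclusion. -/

namespace BalancedSubgraph

open Finset

theorem dg_completeGraph (v : Fin 4) : dg (SimpleGraph.completeGraph (Fin 4)) v = 3 := by
  unfold dg
  convert (by decide : ∀ v : Fin 4, (univ.filter fun w => v ≠ w).card = 3) v

theorem dg_completeBipartiteGraph (v : Fin 3 ⊕ Fin 3) :
    dg (completeBipartiteGraph (Fin 3) (Fin 3)) v = 3 := by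
  unfold dg
  convert (by decide : ∀ v : Fin 3 ⊕ Fin 3,
    (univ.filter fun w : Fin 3 ⊕ Fin 3 => v.isLeft ∧ w.isRight ∨ v.isRight ∧ w.isLeft).card = 3) v
  simp

theorem exists_eq_bip {H : SimpleGraph (Fin 3 ⊕ Fin 3)}
    (hle : H ≤ completeBipartiteGraph (Fin 3) (Fin 3)) : ∃ M, H = bip M := by
  classical
  refine ⟨fun i j => decide (H.Adj (Sum.inl i) (Sum.inr j)), ?_⟩
  ext x y
  rcases x with i | i <;> rcases y with j | j
  · exact iff_of_false (fun h => by simpa using hle h) id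
  · simp [bip]
  · simp [bip, SimpleGraph.adj_comm]
  · exact iff_of_false (fun h => by simpa using hle h) id

/-- Since n/4 = 3/2, balance means that every count is 1 or 2; this is refuted by running through
the 2⁹ biadjacency matrices. -/
theorem cnt_bip (M : Fin 3 → Fin 3 → Bool) : ¬ (cnt (bip M) 0 ∈ Icc 1 2 ∧
    cnt (bip M) 1 ∈ Icc 1 2 ∧ cnt (bip M) 2 ∈ Icc 1 2 ∧ cnt (bip M) 3 ∈ Icc 1 2) := by
  simp only [cnt_eq_card]
  revert M
  decide +kernel

/-- Three disjoint complete graphs on four vertices. -/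
abbrev threeK4 : SimpleGraph ((Fin 4 ⊕ Fin 4) ⊕ Fin 4) :=
  SimpleGraph.sum (SimpleGraph.sum (SimpleGraph.completeGraph (Fin 4))
    (SimpleGraph.completeGraph (Fin 4))) (SimpleGraph.completeGraph (Fin 4))

theorem dg_threeK4 (v : (Fin 4 ⊕ Fin 4) ⊕ Fin 4) : dg threeK4 v = 3 :=
  dg_sum_graph (dg_sum_graph dg_completeGraph dg_completeGraph) dg_completeGraph v

section Negative

theorem not_hasDegreeBalancedSubgraph_completeGraph :
    ¬ HasDegreeBalancedSubgraph (SimpleGraph.completeGraph (Fin 4)) (1 / 2) := by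
  rintro ⟨H, -, hH⟩
  have h : ∀ k ≤ 3, cnt H k ≠ 0 := by
    intro k hk h0
    have := hH k hk
    rw [degreeCount_eq_cnt, h0] at this
    norm_num at this
  obtain h' | h' := cnt_zero_eq_or_cnt_three_eq (H := H) dg_completeGraph
  · exact h 0 (by norm_num) h'
  · exact h 3 le_rfl h'

theorem not_hasDegreeBalancedSubgraph_completeBipartiteGraph :
    ¬ HasDegreeBalancedSubgraph (completeBipartiteGraph (Fin 3) (Fin 3)) (1 / 2) := by
  rintro ⟨H, hle, hH⟩
  obtain ⟨M, rfl⟩ := exists_eq_bip hle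
  have h : ∀ k ≤ 3, cnt (bip M) k ∈ Icc 1 2 := by
    intro k hk
    have := hH k hk
    rw [degreeCount_eq_cnt, abs_le] at this
    norm_num at this
    rw [mem_Icc]
    refine ⟨?_, this.2⟩
    have h1 : (1 : ℝ) ≤ cnt (bip M) k := by linarith
    exact_mod_cast h1
  exact cnt_bip M ⟨h 0 (by norm_num), h 1 (by norm_num), h 2 (by norm_num), h 3 le_rfl⟩

/-- All counts must equal 3. No copy contains exactly three vertices of degree 0, so these occupy at
least two copies, and so do those of degree 3. No copy has both kinds, and there are only three
copies. -/
theorem not_hasDegreeBalancedSubgraph_threeK4 : ¬ HasDegreeBalancedSubgraph threeK4 (1 / 2) := by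
  rintro ⟨H, hle, hH⟩
  have h : ∀ k ≤ 3, cnt H k = 3 := by
    intro k hk
    have := hH k hk
    rw [degreeCount_eq_cnt, abs_le] at this
    norm_num at this
    have h1 : (2 : ℝ) < cnt H k := by linarith
    have h2 : (cnt H k : ℝ) < 4 := by linarith
    have h1' : 2 < cnt H k := by exact_mod_cast h1
    have h2' : cnt H k < 4 := by exact_mod_cast h2
    omega
  have key : ∀ K : SimpleGraph (Fin 4), (cnt K 0 = 0 ∨ cnt K 3 = 0) ∧ cnt K 0 + 1 ≠ 4 ∧
      cnt K 3 + 1 ≠ 4 := fun K => by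
    refine ⟨cnt_zero_eq_or_cnt_three_eq dg_completeGraph, ?_, ?_⟩
    · simpa using cnt_zero_add_one_ne K
    · simpa using cnt_three_add_one_ne (H := K) dg_completeGraph le_top
  have hadd : ∀ k, cnt H k = cnt ((H.comap Sum.inl).comap Sum.inl) k +
      cnt ((H.comap Sum.inl).comap Sum.inr) k + cnt (H.comap Sum.inr) k := by
    intro k
    rw [cnt_eq_add (fun a b hab => by simpa using hle hab),
      cnt_eq_add (H := H.comap Sum.inl) (fun a b hab => by simpa using hle hab)]
  have k1 := key ((H.comap Sum.inl).comap Sum.inl)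
  have k2 := key ((H.comap Sum.inl).comap Sum.inr)
  have k3 := key (H.comap Sum.inr)
  have h0 := (hadd 0).symm.trans (h 0 (by norm_num))
  have h3 := (hadd 3).symm.trans (h 3 le_rfl)
  omega

end Negative

variable {V : Type*} [Fintype V] {G : SimpleGraph V}

theorem isExceptionalCubic_or_good (hG : ∀ v, dg G v = 3) :
    IsExceptionalCubic G ∨ Good G univ := by
  classical
  obtain h | h := (univ : Finset V).eq_empty_or_nonempty
  · exact Or.inr ⟨0, Or.inl ⟨⊥, bot_le, by simp [h]⟩⟩
  obtain h | h | h | ⟨A, B, C, -, -, -, hAB, hABC, kA, kB, kC, hABCS⟩ :=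
    Closed.reduced hG (fun _ _ y _ => mem_univ y) h
  · exact Or.inr h
  · exact Or.inl (Or.inl (h.nonempty_iso fun a b => by rw [dg_completeGraph, hG]))
  · exact Or.inl (Or.inr (Or.inr (h.nonempty_iso fun a b => by
      rw [dg_completeBipartiteGraph, hG])))
  · have hcopy := (kA.sum kB hAB).sum kC hABC
    rw [hABCS] at hcopy
    exact Or.inl (Or.inr (Or.inl (hcopy.nonempty_iso fun a b => by
      rw [dg_threeK4, hG])))

theorem ach_of_iso_threeK4 (e : G ≃g threeK4) : Ach G univ 3 4 3 2 := by
  have h := (isCopy_of_iso e).ach (H := SimpleGraph.sum (SimpleGraph.sum (quad [(0, 1)])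
    (quad [(0, 2), (0, 3), (1, 2), (1, 3), (2, 3)])) (quad [(0, 1), (1, 2)])) (sum_graph_mono
    (sum_graph_mono le_top le_top) le_top)
  simp only [cnt_sum_graph, cnt_eq_card] at h
  exact h

theorem IsExceptionalCubic.not_hasDegreeBalancedSubgraph (h : IsExceptionalCubic G) :
    ¬ HasDegreeBalancedSubgraph G (1 / 2) := by
  intro hG
  obtain ⟨⟨e⟩⟩ | ⟨⟨e⟩⟩ | ⟨⟨e⟩⟩ := h
  · exact not_hasDegreeBalancedSubgraph_completeGraph (HasDegreeBalancedSubgraph.of_iso e hG)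
  · exact not_hasDegreeBalancedSubgraph_threeK4 (HasDegreeBalancedSubgraph.of_iso e hG)
  · exact not_hasDegreeBalancedSubgraph_completeBipartiteGraph (HasDegreeBalancedSubgraph.of_iso e hG)

theorem IsExceptionalCubic.hasDegreeBalancedSubgraph (hG : ∀ v, dg G v = 3)
    (h : IsExceptionalCubic G) : HasDegreeBalancedSubgraph G (3 / 2) := by
  obtain ⟨⟨e⟩⟩ | ⟨⟨e⟩⟩ | ⟨⟨e⟩⟩ := h
  · have h : IsK4 G univ := isCopy_of_iso e
    apply h.ach1210.hasDegreeBalancedSubgraph hG <;> norm_num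
  · apply (ach_of_iso_threeK4 e).hasDegreeBalancedSubgraph hG <;> norm_num
  · have h : IsK33 G univ := isCopy_of_iso e
    apply h.ach1311.hasDegreeBalancedSubgraph hG <;> norm_num [abs_le]

theorem HasDegreeBalancedSubgraph.mono {r s : ℝ} (hrs : r ≤ s)
    (h : HasDegreeBalancedSubgraph G r) : HasDegreeBalancedSubgraph G s := by
  obtain ⟨H, hle, hH⟩ := h
  exact ⟨H, hle, fun k hk => (hH k hk).trans hrs⟩

end BalancedSubgraph

open BalancedSubgraph in
theorem mainTheorem4 {V : Type*} [Fintype V] (G : SimpleGraph V) [G.LocallyFinite]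
    (hG : G.IsRegularOfDegree 3) :
    (¬ IsExceptionalCubic G → HasDegreeBalancedSubgraph G (1 / 2)) ∧
    (IsExceptionalCubic G →
      ¬ HasDegreeBalancedSubgraph G (1 / 2) ∧ HasDegreeBalancedSubgraph G (3 / 2)) ∧
    HasDegreeBalancedSubgraph G 2 := by
  have hdg : ∀ v, dg G v = 3 := by
    intro v
    rw [← hG v, ← SimpleGraph.card_neighborFinset_eq_degree]
    unfold dg
    congr 1
    ext w
    simp
  refine ⟨fun h => ?_, fun h => ⟨h.not_hasDegreeBalancedSubgraph,
    h.hasDegreeBalancedSubgraph hdg⟩, ?_⟩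
  · exact ((isExceptionalCubic_or_good hdg).resolve_left h).hasDegreeBalancedSubgraph hdg
  · obtain h | h := isExceptionalCubic_or_good hdg
    · exact HasDegreeBalancedSubgraph.mono (by norm_num) (h.hasDegreeBalancedSubgraph hdg)
    · exact HasDegreeBalancedSubgraph.mono (by norm_num) (h.hasDegreeBalancedSubgraph hdg)
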